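/- **Theorem.** Let $G=(V,E)$ be an infinite, connected, locally finite graph with root $o\in V$ and graph distance $d$. Write $N_x$ for the set of neighbours of $x$, $B_r=\{x: d(o,x)\le r\}$ and $L_r=\{x: d(o,x)=r\}$. Assume that $G$ is $(g,o)$-growing with integer parameter $g>0$, that is, $$\min_{r\ge 0,\;x\in L_r}\bigl(|N_x\cap L_{r+1}|-|N_x\cap B_r|\bigr)=g,$$ and that every vertex has degree at most $\Delta$. For $m\ge 0$ let $B=B_m$, let $\partial_V B$ be the set of vertices outside $B$ with a neighbour in $B$, let $\Omega^+$ be the set of configurations $\sigma\in\{\pm1\}^{B\cup\partial_V B}$ equal to $+1$ on $\partial_V B$, and let $$\mu(\sigma)=\frac1Z\exp\Bigl(\beta\sum_{\{x,y\}}\sigma_x\sigma_y\Bigr),\qquad\sigma\in\Omega^+,$$ where the sum runs over the edges of $G$ with both endpoints in $B\cup\partial_V B$, be the Ising Gibbs measure on $B$ at inverse temperature $\beta$ with plus boundary condition and zero external field. For $0\le i\le m$, $S\subseteq L_i$ and $\tau\in\Omega^+$, let $\nu_S^\tau$ be the probability measure on $\{\pm1\}^S$ that is the marginal on $S$ of $\mu$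 conditioned on the event $\{\eta\in\Omega^+:\eta=\tau\text{ on }B_i\setminus S\}$. For $x\in S$ and $f:\{\pm1\}^S\to\mathbb R$ let $\mathrm{Var}_x(f)(\xi)$ be the variance of $f$ under $\nu_S^\tau$ conditioned on the spins in $S\setminus\{x\}$ being those of $\xi$. For all $\Delta$ and $g$ there are a function $c_0=c_0(\beta,\Delta,g)$ and constants $c>0$ and $\beta_0$, depending only on $\Delta$ and $g$, such that $$c_0(\beta,\Delta,g)=1+O(e^{-c\beta})\quad\text{as }\beta\to\infty,$$ and for every $\beta\ge\beta_0$, every such graph $G$ and root $o$, all $0\le i\le m$, every $S\subseteq L_i$, every $\tau\in\Omega^+$ and every $f:\{\pm1\}^S\to\mathbb R$, $$\mathrm{Var}_{\nu_S^\tau}(f)\;\le\; c_0\sum_{x\in S}\nu_S^\tau\bigl(\mathrm{Var}_x(f)\bigr).$$ -/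

import Mathlib

open Filter Asymptotics

noncomputable section

namespace IsingPlus

variable {V : Type*}

/-! ### Balls, levels and growing graphs -/

/-- In a locally finite graph, closed balls for the graph distance are finite. -/
theorem finite_closedBall (G : SimpleGraph V) [G.LocallyFinite] (o : V) (r : ℕ) :
    {x : V | G.edist o x ≤ r}.Finite := by
  induction r with
  | zero =>
    refine (Set.finite_singleton o).subset ?_
    intro x hx
    have hx0 : G.edist o x = 0 := le_antisymm (le_of_le_of_eq hx Nat.cast_zero) bot_le
    exact (SimpleGraph.edist_eq_zero_iff.mp hx0).symm
  | succ r ih =>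
    refine ((Set.finite_singleton o).union
      (ih.biUnion fun y _ => (G.neighborFinset y).finite_toSet)).subset ?_
    intro x hx
    have hx' : G.edist o x ≤ ((r + 1 : ℕ) : ℕ∞) := hx
    have hne : G.edist x o ≠ ⊤ := by
      rw [SimpleGraph.edist_comm]
      exact ne_top_of_le_ne_top (ENat.natCast_ne_top _) hx'
    obtain ⟨p, hp⟩ := SimpleGraph.exists_walk_of_edist_ne_top hne
    cases p with
    | nil => exact Or.inl rfl
    | @cons _ y _ h q =>
      refine Or.inr (Set.mem_biUnion (x := y) ?_ ?_)
      · have h1 : ((q.length + 1 : ℕ) : ℕ∞) ≤ ((r + 1 : ℕ) : ℕ∞) := by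
          rw [SimpleGraph.edist_comm, ← hp] at hx'
          simpa using hx'
        have h2 : q.length ≤ r := by
          have h3 := Nat.cast_le.mp h1
          omega
        have h4 : G.edist o y ≤ (q.length : ℕ∞) := by
          rw [SimpleGraph.edist_comm]
          exact SimpleGraph.edist_le q
        exact h4.trans (by exact_mod_cast h2)
      · simpa using h.symm

/-- The ball `B_r(o) = {x : d(o, x) ≤ r}`. -/
def ball (G : SimpleGraph V) [G.LocallyFinite] (o : V) (r : ℕ) : Finset V :=
  (finite_closedBall G o r).toFinset

@[simp] theorem mem_ball (G : SimpleGraph V) [G.LocallyFinite] (o : V) (r : ℕ) (x : V) :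
    x ∈ ball G o r ↔ G.edist o x ≤ r := by
  simp [ball]

open Classical in
/-- The level `L_r(o) = {x : d(o, x) = r}`. -/
def level (G : SimpleGraph V) [G.LocallyFinite] (o : V) (r : ℕ) : Finset V :=
  {x ∈ ball G o r | G.edist o x = r}

@[simp] theorem mem_level (G : SimpleGraph V) [G.LocallyFinite] (o : V) (r : ℕ) (x : V) :
    x ∈ level G o r ↔ G.edist o x = r := by
  simp only [level, Finset.mem_filter, mem_ball, and_iff_right_iff_imp]
  exact fun h => h.le

open Classical in
/-- `G` is growing with parameter `g > 0` and root `o`: the minimum over all `r ≥ 0` and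
`x ∈ L_r(o)` of `|N_x ∩ L_{r+1}(o)| - |N_x ∩ B_r(o)|` is equal to `g`. -/
def IsGrowing (G : SimpleGraph V) [G.LocallyFinite] (g : ℕ) (o : V) : Prop :=
  0 < g ∧
    IsLeast {k : ℤ | ∃ r : ℕ, ∃ x ∈ level G o r,
      k = ((G.neighborFinset x ∩ level G o (r + 1)).card : ℤ)
        - ((G.neighborFinset x ∩ ball G o r).card : ℤ)} (g : ℤ)

/-! ### The Ising model -/

open Classical in
/-- `A ∪ ∂_V A`, where the vertex boundary `∂_V A` is the set of the vertices outside `A` that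
have a neighbour in `A`. -/
def closure (G : SimpleGraph V) [G.LocallyFinite] (A : Finset V) : Finset V :=
  A ∪ A.biUnion fun x => G.neighborFinset x

/-- Spin configurations that agree with `η` outside the finite set `A`. The Gibbs measure on `A`
only involves their values on `A ∪ ∂_V A`. -/
abbrev Config (A : Finset V) (η : V → ℤˣ) : Type _ :=
  {σ : V → ℤˣ // ∀ x, x ∉ A → σ x = η x}

instance (A : Finset V) (η : V → ℤˣ) : Finite (Config A η) := by
  refine Finite.of_injective (fun (σ : Config A η) (x : A) => σ.1 x) ?_
  intro σ σ' h
  refine Subtype.ext (funext fun x => ?_)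
  by_cases hx : x ∈ A
  · exact congrFun h ⟨x, hx⟩
  · rw [σ.2 x hx, σ'.2 x hx]

instance (A : Finset V) (η : V → ℤˣ) : Fintype (Config A η) := Fintype.ofFinite _

open Classical in
/-- The sum of `σ_x σ_y` over the edges `{x, y}` of the subgraph induced on `A ∪ ∂_V A`. The double
sum runs over ordered pairs, hence the factor `1 / 2`. -/
def interaction (G : SimpleGraph V) [G.LocallyFinite] (A : Finset V) (σ : V → ℤˣ) : ℝ :=
  (1 / 2) * ∑ x ∈ closure G A, ∑ y ∈ closure G A with G.Adj x y,
    ((σ x : ℤ) : ℝ) * ((σ y : ℤ) : ℝ)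

/-- The Gibbs measure `μ_A^η` at inverse temperature `β` and zero external field. -/
def gibbs (G : SimpleGraph V) [G.LocallyFinite] (β : ℝ) (A : Finset V) (η : V → ℤˣ)
    (σ : Config A η) : ℝ :=
  Real.exp (β * interaction G A σ.1) /
    ∑ σ' : Config A η, Real.exp (β * interaction G A σ'.1)

/-- `Ω⁺`: the configurations on `B_m(o)` with plus boundary condition. -/
abbrev PlusConfig (G : SimpleGraph V) [G.LocallyFinite] (o : V) (m : ℕ) : Type _ :=
  Config (ball G o m) (fun _ => 1)

/-- `μ = μ_B^+`: the Gibbs measure on `B = B_m(o)` with plus boundary condition. -/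
def plusGibbs (G : SimpleGraph V) [G.LocallyFinite] (β : ℝ) (o : V) (m : ℕ) :
    PlusConfig G o m → ℝ :=
  gibbs G β (ball G o m) (fun _ => 1)

open Classical in
/-- `ν_S^τ`: the marginal on `S` of the measure `μ = μ_B^+` conditioned on the event that the
configuration coincides with `τ` on `B_i ∖ S`. -/
def marginal (G : SimpleGraph V) [G.LocallyFinite] (β : ℝ) (o : V) (m i : ℕ) (S : Finset V)
    (τ : PlusConfig G o m) (ξ : S → ℤˣ) : ℝ :=
  (∑ η : PlusConfig G o m with
      (∀ x : S, η.1 x = ξ x) ∧ ∀ x ∈ ball G o i, x ∉ S → η.1 x = τ.1 x,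
      plusGibbs G β o m η) /
    ∑ η : PlusConfig G o m with ∀ x ∈ ball G o i, x ∉ S → η.1 x = τ.1 x,
      plusGibbs G β o m η

/-! ### Variances of functions of the spins in `S` -/

section Variance

variable {S : Finset V}

open Classical in
/-- The expectation `ν(f)`. -/
def expect (ν : (S → ℤˣ) → ℝ) (f : (S → ℤˣ) → ℝ) : ℝ :=
  ∑ ξ : S → ℤˣ, ν ξ * f ξ

/-- The variance `Var_ν(f) = ν(f²) - ν(f)²`. -/
def variance (ν : (S → ℤˣ) → ℝ) (f : (S → ℤˣ) → ℝ) : ℝ :=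
  expect ν (fun ξ => f ξ ^ 2) - expect ν f ^ 2

open Classical in
/-- The expectation of `f` for the measure `ν` conditioned on the spins of `ξ` in `S ∖ {x}`. -/
def siteExpect (ν : (S → ℤˣ) → ℝ) (x : S) (f : (S → ℤˣ) → ℝ) (ξ : S → ℤˣ) : ℝ :=
  (∑ a : ℤˣ, ν (Function.update ξ x a) * f (Function.update ξ x a)) /
    ∑ a : ℤˣ, ν (Function.update ξ x a)

/-- `Var_x(f)`: the variance of `f` for the measure `ν` conditioned on the spins of `ξ` in
`S ∖ {x}`, as a function of `ξ`. -/
def siteVariance (ν : (S → ℤˣ) → ℝ) (x : S) (f : (S → ℤˣ) → ℝ) (ξ : S → ℤˣ) : ℝ :=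
  siteExpect ν x (fun ζ => f ζ ^ 2) ξ - siteExpect ν x f ξ ^ 2

end Variance

end IsingPlus

end

noncomputable section

namespace IsingPlus

variable {V : Type*}

/-! ### Dobrushin's condition implies the Poincaré inequality -/

section Dobrushin

variable {S : Finset V} {ν : (S → ℤˣ) → ℝ}

/-! The measure ν_S^τ satisfies Dobrushin's condition with total influence ε = 16 Δ³ e^{-2β}, and
Dobrushin's condition yields a Poincaré inequality with constant 1 / (1 - ε).

Poincaré from Dobrushin (`variance_le_of_influenceBound`): let T = ∑ₓ Eₓ be the sum of the one-site
conditional expectations. T multiplies the total oscillation of a function by at most |S| - 1 + ε. T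
is also self-adjoint in L²(ν), so the squared norms of the iterates Tⁿ f form a log-convex sequence.
The contraction of oscillations therefore becomes an L² bound on mean-zero functions, and this bound
is the spectral gap.

Influences (`abs_minusProb_sub_le`): fix all of B_i except x, under two boundary conditions that
differ only at y, and take two independent replicas. If the cluster at x of sites where the replicas
are not both plus is not adjacent to y, exchanging the replicas inside it preserves the weight, and
such pairs cancel. What remains is the probability of a cluster joining x to y, summed over
connected sets.

Peierls (`IsGrowing.peierls`): every site has at least one more neighbour in the next level than in
its own ball. The neighbours above are free or plus, so turning a minus cluster to plus gains energy
at least 2 per site, however adverse the conditioning on B_i is. Each cluster D then costs (4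
e^{-2β})^|D|, which beats the exponential number of connected sets once β is large. -/

theorem sum_intUnits {M : Type*} [AddCommMonoid M] (F : ℤˣ → M) : ∑ a : ℤˣ, F a = F 1 + F (-1) := by
  have h : (Finset.univ : Finset ℤˣ) = {1, -1} := by decide
  rw [h, Finset.sum_pair (by decide)]

open Classical in
-- Resampling the spin at x gives the configuration itself and its flip at x, and flipping is an
-- involution of the configuration space.
theorem sum_update_eq (x : S) (F : (S → ℤˣ) → ℝ) :
    ∑ ξ : S → ℤˣ, ∑ a : ℤˣ, F (Function.update ξ x a) = 2 * ∑ ξ : S → ℤˣ, F ξ := by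
  have h1 : ∀ ξ : S → ℤˣ, ∑ a : ℤˣ, F (Function.update ξ x a)
      = F ξ + F (Function.update ξ x (-ξ x)) := by
    intro ξ
    rw [sum_intUnits]
    rcases Int.units_eq_one_or (ξ x) with h | h
    · rw [h, ← h, Function.update_eq_self]
    · have h' : (1 : ℤˣ) = - ξ x := by rw [h, neg_neg]
      rw [h, neg_neg, add_comm, ← h, Function.update_eq_self]
  have hinv : Function.Involutive (fun ξ : S → ℤˣ => Function.update ξ x (-ξ x)) := by
    intro ξ
    simp
  rw [Finset.sum_congr rfl fun ξ _ => h1 ξ, Finset.sum_add_distrib,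
    Equiv.sum_comp hinv.toPerm F |> fun h => (show ∑ ξ : S → ℤˣ, F (Function.update ξ x (-ξ x)) = _ from h)]
  ring

open Classical in
theorem siteExpect_update (x : S) (f : (S → ℤˣ) → ℝ) (ξ : S → ℤˣ) (a : ℤˣ) :
    siteExpect ν x f (Function.update ξ x a) = siteExpect ν x f ξ := by
  simp [siteExpect]

open Classical in
theorem sum_update_pos (hν : ∀ ξ, 0 < ν ξ) (x : S) (ξ : S → ℤˣ) :
    0 < ∑ a : ℤˣ, ν (Function.update ξ x a) :=
  Finset.sum_pos (fun _ _ => hν _) Finset.univ_nonempty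

theorem expect_siteExpect (hν : ∀ ξ, 0 < ν ξ) (x : S) (f : (S → ℤˣ) → ℝ) :
    expect ν (siteExpect ν x f) = expect ν f := by
  classical
  have h1 := sum_update_eq x (fun ξ => ν ξ * siteExpect ν x f ξ)
  have h2 := sum_update_eq x (fun ξ => ν ξ * f ξ)
  have h3 : ∀ ξ : S → ℤˣ, ∑ a : ℤˣ, ν (Function.update ξ x a) *
      siteExpect ν x f (Function.update ξ x a) =
      ∑ a : ℤˣ, ν (Function.update ξ x a) * f (Function.update ξ x a) := by
    intro ξ
    simp only [siteExpect_update]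
    rw [← Finset.sum_mul]
    unfold siteExpect
    exact mul_div_cancel₀ _ (sum_update_pos hν x ξ).ne'
  simp only [h3] at h1
  have : ∑ ξ : S → ℤˣ, ν ξ * siteExpect ν x f ξ = ∑ ξ : S → ℤˣ, ν ξ * f ξ := by linarith
  unfold expect
  convert this

theorem siteExpect_mul (x : S) (f h : (S → ℤˣ) → ℝ) (ξ : S → ℤˣ) :
    siteExpect ν x (fun ζ => siteExpect ν x h ζ * f ζ) ξ
      = siteExpect ν x h ξ * siteExpect ν x f ξ := by
  classical
  rw [siteExpect.eq_1 ν x (fun ζ => siteExpect ν x h ζ * f ζ)]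
  simp only [siteExpect_update]
  rw [siteExpect.eq_1 ν x f, ← mul_div_assoc, Finset.mul_sum]
  congr 1
  exact Finset.sum_congr rfl fun a _ => by ring

/-- This says that `siteExpect` at x is an orthogonal projection in L²(ν); self-adjointness of
`heatBath` follows by summing over x. -/
theorem expect_siteExpect_mul (hν : ∀ ξ, 0 < ν ξ) (x : S) (f h : (S → ℤˣ) → ℝ) :
    expect ν (fun ξ => siteExpect ν x h ξ * f ξ)
      = expect ν (fun ξ => siteExpect ν x h ξ * siteExpect ν x f ξ) := by
  rw [← expect_siteExpect hν x]
  exact congrArg _ (funext fun ξ => siteExpect_mul x f h ξ)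

theorem expect_add (f h : (S → ℤˣ) → ℝ) :
    expect ν (fun ξ => f ξ + h ξ) = expect ν f + expect ν h := by
  simp only [expect, mul_add, Finset.sum_add_distrib]

theorem expect_sub (f h : (S → ℤˣ) → ℝ) :
    expect ν (fun ξ => f ξ - h ξ) = expect ν f - expect ν h := by
  simp only [expect, mul_sub, Finset.sum_sub_distrib]

theorem expect_const_mul (a : ℝ) (f : (S → ℤˣ) → ℝ) :
    expect ν (fun ξ => a * f ξ) = a * expect ν f := by
  simp only [expect, Finset.mul_sum]
  exact Finset.sum_congr rfl fun _ _ => by ring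

theorem expect_sum {ι : Type*} (s : Finset ι) (f : ι → (S → ℤˣ) → ℝ) :
    expect ν (fun ξ => ∑ i ∈ s, f i ξ) = ∑ i ∈ s, expect ν (f i) := by
  simp only [expect, Finset.mul_sum]
  exact Finset.sum_comm

theorem expect_mono (hν : ∀ ξ, 0 < ν ξ) {f h : (S → ℤˣ) → ℝ} (hfh : ∀ ξ, f ξ ≤ h ξ) :
    expect ν f ≤ expect ν h :=
  Finset.sum_le_sum fun ξ _ => mul_le_mul_of_nonneg_left (hfh ξ) (hν ξ).le

theorem expect_const (h1 : expect ν (fun _ => 1) = 1) (a : ℝ) : expect ν (fun _ => a) = a := by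
  have := expect_const_mul (ν := ν) a (fun _ => 1)
  simpa [h1] using this

theorem expect_mul_sq_le (hν : ∀ ξ, 0 < ν ξ) (f h : (S → ℤˣ) → ℝ) :
    expect ν (fun ξ => f ξ * h ξ) ^ 2
      ≤ expect ν (fun ξ => f ξ ^ 2) * expect ν (fun ξ => h ξ ^ 2) := by
  unfold expect
  refine Finset.sum_sq_le_sum_mul_sum_of_sq_le_mul _ (fun ξ _ => ?_) (fun ξ _ => ?_) fun ξ _ => ?_
  · exact mul_nonneg (hν ξ).le (sq_nonneg _)
  · exact mul_nonneg (hν ξ).le (sq_nonneg _)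
  · exact le_of_eq (by ring)

/-- The generator sum `∑ₓ Eₓ` of the heat-bath dynamics. -/
def heatBath (ν : (S → ℤˣ) → ℝ) (f : (S → ℤˣ) → ℝ) (ξ : S → ℤˣ) : ℝ :=
  ∑ x : S, siteExpect ν x f ξ

theorem expect_heatBath_mul (hν : ∀ ξ, 0 < ν ξ) (f h : (S → ℤˣ) → ℝ) :
    expect ν (fun ξ => heatBath ν f ξ * h ξ) = expect ν (fun ξ => f ξ * heatBath ν h ξ) := by
  simp only [heatBath, Finset.sum_mul, Finset.mul_sum, expect_sum]
  refine Finset.sum_congr rfl fun x _ => ?_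
  rw [expect_siteExpect_mul hν x h f, funext fun ξ => mul_comm (f ξ) (siteExpect ν x h ξ),
    expect_siteExpect_mul hν x f h]
  simp only [mul_comm]

theorem expect_heatBath (hν : ∀ ξ, 0 < ν ξ) (f : (S → ℤˣ) → ℝ) :
    expect ν (heatBath ν f) = S.card * expect ν f := by
  unfold heatBath
  rw [expect_sum]
  simp [expect_siteExpect hν]

/-! ### Oscillations and their contraction under the heat bath. -/

/-- `d y` bounds the change of `f` when only the spin at `y` is modified. -/
def OscBound (f : (S → ℤˣ) → ℝ) (d : S → ℝ) : Prop :=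
  ∀ y ξ ξ', (∀ z, z ≠ y → ξ z = ξ' z) → |f ξ - f ξ'| ≤ d y

theorem OscBound.nonneg {f : (S → ℤˣ) → ℝ} {d : S → ℝ} (h : OscBound f d) (y : S) : 0 ≤ d y :=
  (abs_nonneg _).trans (h y 1 1 fun _ _ => rfl)

/-- Telescoping: ξ' is turned into ξ one site at a time. -/
theorem OscBound.abs_sub_le_sum {f : (S → ℤˣ) → ℝ} {d : S → ℝ} (h : OscBound f d) (ξ ξ' : S → ℤˣ) :
    |f ξ - f ξ'| ≤ ∑ y, d y := by
  classical
  have key : ∀ T : Finset S, |f (T.piecewise ξ ξ') - f ξ'| ≤ ∑ y ∈ T, d y := by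
    intro T
    induction T using Finset.induction_on with
    | empty => simp
    | insert a T ha ih =>
      rw [Finset.sum_insert ha]
      refine (abs_sub_le _ (f (T.piecewise ξ ξ')) _).trans (add_le_add (h a _ _ ?_) ih)
      intro z hz
      by_cases hzT : z ∈ T <;> simp [Finset.piecewise, hz, hzT]
  simpa only [Finset.piecewise_univ] using key Finset.univ

theorem OscBound.abs_le_sum (hν : ∀ ξ, 0 < ν ξ) (h1 : expect ν (fun _ => 1) = 1)
    {f : (S → ℤˣ) → ℝ} {d : S → ℝ} (h : OscBound f d) (hf : expect ν f = 0) (ξ : S → ℤˣ) :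
    |f ξ| ≤ ∑ y, d y := by
  have e : f ξ = expect ν (fun ξ' => f ξ - f ξ') := by
    rw [expect_sub, hf, expect_const h1, sub_zero]
  rw [abs_le]
  constructor
  · rw [e, ← expect_const h1 (-∑ y, d y)]
    exact expect_mono hν fun ξ' => (abs_le.mp (h.abs_sub_le_sum ξ ξ')).1
  · rw [e, ← expect_const h1 (∑ y, d y)]
    exact expect_mono hν fun ξ' => (abs_le.mp (h.abs_sub_le_sum ξ ξ')).2

theorem exists_oscBound (f : (S → ℤˣ) → ℝ) : ∃ d, OscBound f d := by
  classical
  obtain ⟨M, hM⟩ := (Set.finite_range fun p : (S → ℤˣ) × (S → ℤˣ) => |f p.1 - f p.2|).bddAbove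
  exact ⟨fun _ => M, fun y ξ ξ' _ => hM ⟨(ξ, ξ'), rfl⟩⟩

open Classical in
/-- The probability that the spin at `x` is `-1` given the other spins of `ξ`. -/
def minusProb (ν : (S → ℤˣ) → ℝ) (x : S) (ξ : S → ℤˣ) : ℝ :=
  ν (Function.update ξ x (-1)) / ∑ a : ℤˣ, ν (Function.update ξ x a)

open Classical in
theorem siteExpect_eq (hν : ∀ ξ, 0 < ν ξ) (x : S) (f : (S → ℤˣ) → ℝ) (ξ : S → ℤˣ) :
    siteExpect ν x f ξ = minusProb ν x ξ * f (Function.update ξ x (-1))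
      + (1 - minusProb ν x ξ) * f (Function.update ξ x 1) := by
  have h := (sum_update_pos hν x ξ).ne'
  unfold siteExpect minusProb
  rw [sum_intUnits] at h
  simp only [sum_intUnits]
  field_simp
  ring

theorem minusProb_mem (hν : ∀ ξ, 0 < ν ξ) (x : S) (ξ : S → ℤˣ) :
    0 ≤ minusProb ν x ξ ∧ minusProb ν x ξ ≤ 1 := by
  classical
  refine ⟨div_nonneg (hν _).le (Finset.sum_nonneg fun _ _ => (hν _).le),
    div_le_one_of_le₀ ?_ (Finset.sum_nonneg fun _ _ => (hν _).le)⟩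
  rw [sum_intUnits]
  linarith [hν (Function.update ξ x 1)]

/-- Dobrushin's influence bounds: `c x y` bounds the influence of the spin at `y` on the
conditional law of the spin at `x`. -/
def InfluenceBound (ν : (S → ℤˣ) → ℝ) (c : S → S → ℝ) : Prop :=
  ∀ x y, x ≠ y → ∀ ξ ξ' : S → ℤˣ, (∀ z, z ≠ y → ξ z = ξ' z) →
    |minusProb ν x ξ - minusProb ν x ξ'| ≤ c x y

/-- Changing the spin at y acts twice on the average over x: through f, which costs `d y`, and
through the law of the spin at x, which costs its change of probability times the oscillation of f
at x. -/
theorem OscBound.siteExpect_sub_le (hν : ∀ ξ, 0 < ν ξ) {c : S → S → ℝ} (hc : InfluenceBound ν c)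
    {f : (S → ℤˣ) → ℝ} {d : S → ℝ} (h : OscBound f d) {x y : S} (hxy : x ≠ y)
    {ξ ξ' : S → ℤˣ} (hξ : ∀ z, z ≠ y → ξ z = ξ' z) :
    |siteExpect ν x f ξ - siteExpect ν x f ξ'| ≤ d y + c x y * d x := by
  classical
  have hu : ∀ a, |f (Function.update ξ x a) - f (Function.update ξ' x a)| ≤ d y := by
    intro a
    refine h y _ _ fun z hz => ?_
    by_cases hzx : z = x
    · subst hzx; simp
    · simp [hzx, hξ z hz]
  have hx : |f (Function.update ξ' x (-1)) - f (Function.update ξ' x 1)| ≤ d x :=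
    h x _ _ fun z hz => by simp [hz]
  obtain ⟨p0, p1⟩ := minusProb_mem hν x ξ
  have hp := hc x y hxy ξ ξ' hξ
  rw [siteExpect_eq hν, siteExpect_eq hν]
  set p := minusProb ν x ξ
  set p' := minusProb ν x ξ'
  have e : p * f (Function.update ξ x (-1)) + (1 - p) * f (Function.update ξ x 1) -
      (p' * f (Function.update ξ' x (-1)) + (1 - p') * f (Function.update ξ' x 1)) =
      p * (f (Function.update ξ x (-1)) - f (Function.update ξ' x (-1))) +
      (1 - p) * (f (Function.update ξ x 1) - f (Function.update ξ' x 1)) +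
      (p - p') * (f (Function.update ξ' x (-1)) - f (Function.update ξ' x 1)) := by ring
  rw [e]
  refine (abs_add_three _ _ _).trans ?_
  rw [abs_mul, abs_mul, abs_mul, abs_of_nonneg p0, abs_of_nonneg (sub_nonneg.2 p1)]
  have h1 := mul_le_mul_of_nonneg_left (hu (-1)) p0
  have h2 := mul_le_mul_of_nonneg_left (hu 1) (sub_nonneg.2 p1)
  have h3 := mul_le_mul hp hx (abs_nonneg _) ((abs_nonneg _).trans hp)
  linarith

/-- The average over the spin at y no longer depends on that spin, so only |S| - 1 terms of the sum
feel a change at y; this missing term is the source of the gap. The influences add ∑ₓ (∑_y c x y) d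
x, where nonnegative diagonal terms are put back so that full sums over y can be bounded by ε. -/
theorem OscBound.exists_heatBath (hν : ∀ ξ, 0 < ν ξ) {c : S → S → ℝ} (hc : InfluenceBound ν c)
    {ε : ℝ} (hc0 : ∀ x y, 0 ≤ c x y) (hε : ∀ x, ∑ y, c x y ≤ ε)
    {f : (S → ℤˣ) → ℝ} {d : S → ℝ} (h : OscBound f d) :
    ∃ d', OscBound (heatBath ν f) d' ∧ ∑ y, d' y ≤ (S.card - 1 + ε) * ∑ y, d y := by
  classical
  refine ⟨fun y => ∑ x ∈ Finset.univ.erase y, (d y + c x y * d x), ?_, ?_⟩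
  · intro y ξ ξ' hξ
    unfold heatBath
    rw [← Finset.sum_sub_distrib]
    refine (Finset.abs_sum_le_sum_abs _ _).trans ?_
    rw [← Finset.add_sum_erase _ _ (Finset.mem_univ y)]
    have h0 : siteExpect ν y f ξ - siteExpect ν y f ξ' = 0 := by
      have : ξ' = Function.update ξ y (ξ' y) := by
        ext z
        by_cases hz : z = y
        · subst hz; simp
        · simp [hz, hξ z hz]
      rw [this, siteExpect_update, sub_self]
    rw [h0, abs_zero, zero_add]
    exact Finset.sum_le_sum fun x hx => h.siteExpect_sub_le hν hc (Finset.ne_of_mem_erase hx) hξ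
  · have h1 : ∀ y, ∑ x ∈ Finset.univ.erase y, (d y + c x y * d x) ≤
        (S.card - 1 : ℝ) * d y + ∑ x, c x y * d x := by
      intro y
      rw [Finset.sum_add_distrib, Finset.sum_const, Finset.card_erase_of_mem (Finset.mem_univ y),
        nsmul_eq_mul]
      have hS : 1 ≤ (Finset.univ : Finset S).card := Finset.card_pos.2 ⟨y, Finset.mem_univ y⟩
      rw [Nat.cast_sub hS]
      refine add_le_add (by simp) (Finset.sum_le_sum_of_subset_of_nonneg (Finset.erase_subset _ _)
        fun x _ _ => mul_nonneg (hc0 _ _) (h.nonneg x))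
    refine (Finset.sum_le_sum fun y _ => h1 y).trans ?_
    rw [Finset.sum_add_distrib, ← Finset.mul_sum, Finset.sum_comm, add_mul (_ - _)]
    refine add_le_add le_rfl ?_
    rw [Finset.mul_sum]
    refine Finset.sum_le_sum fun x _ => ?_
    rw [← Finset.sum_mul]
    exact mul_le_mul_of_nonneg_right (hε x) (h.nonneg x)

/-! ### From contraction of oscillations to the spectral gap. -/

/-- A nonnegative log-convex sequence dominated by a geometric one has first ratio at most the
geometric ratio. -/
theorem le_mul_of_logConvex {a : ℕ → ℝ} {C r : ℝ} (ha : ∀ n, 0 ≤ a n)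
    (hconv : ∀ n, a (n + 1) ^ 2 ≤ a n * a (n + 2)) (hr : 0 ≤ r) (hC : ∀ n, a n ≤ C * r ^ n) :
    a 1 ≤ r * a 0 := by
  by_contra! hlt
  have h0 : 0 < a 0 := by
    rcases (ha 0).eq_or_lt with h | h
    · have := hconv 0
      rw [← h, zero_mul] at this
      rw [← h, mul_zero] at hlt
      simp only [zero_add] at this
      nlinarith
    · exact h
  set q := a 1 / a 0 with hq
  have hqr : r < q := by rw [hq, lt_div_iff₀ h0]; exact hlt
  have hq0 : 0 < q := hr.trans_lt hqr
  -- Log-convexity makes the successive ratios nondecreasing, so all of them are at least q > r; the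
  -- resulting growth q ^ n contradicts the bound C * r ^ n.
  have hstep : ∀ n, 0 < a n ∧ q * a n ≤ a (n + 1) := by
    intro n
    induction n with
    | zero => exact ⟨h0, by rw [hq, div_mul_cancel₀ _ h0.ne']⟩
    | succ n ih =>
      have hp : 0 < a (n + 1) := (mul_pos hq0 ih.1).trans_le ih.2
      refine ⟨hp, ?_⟩
      have h1 := hconv n
      have h2 : a (n + 1) * (q * a n) ≤ a (n + 1) * a (n + 1) :=
        mul_le_mul_of_nonneg_left ih.2 hp.le
      have h3 : a n * (q * a (n + 1)) ≤ a n * a (n + 2) := by nlinarith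
      exact le_of_mul_le_mul_left h3 ih.1
  have hgeo : ∀ n, a 0 * q ^ n ≤ a n := by
    intro n
    induction n with
    | zero => simp
    | succ n ih =>
      rw [pow_succ]
      nlinarith [(hstep n).2]
  have hlim : Tendsto (fun n : ℕ => C * (r / q) ^ n) atTop (nhds 0) := by
    simpa using (tendsto_pow_atTop_nhds_zero_of_lt_one (div_nonneg hr hq0.le)
      ((div_lt_one hq0).2 hqr)).const_mul C
  have hle : a 0 ≤ 0 := by
    refine ge_of_tendsto' hlim fun n => ?_
    rw [div_pow, ← mul_div_assoc, le_div_iff₀ (pow_pos hq0 n)]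
    exact (hgeo n).trans (hC n)
  exact absurd h0 hle.not_gt

/-- The bound on oscillations controls the sup norm of the iterates with a prefactor depending on f.
Log-convexity removes this prefactor, so that a single application of `heatBath` contracts by ρ in
L². -/
theorem expect_mul_heatBath_le (hν : ∀ ξ, 0 < ν ξ) (h1 : expect ν (fun _ => 1) = 1)
    {c : S → S → ℝ} (hc : InfluenceBound ν c) {ε : ℝ} (hc0 : ∀ x y, 0 ≤ c x y)
    (hε0 : 0 ≤ ε) (hε : ∀ x, ∑ y, c x y ≤ ε) (hS : S.Nonempty)
    {f : (S → ℤˣ) → ℝ} (hf : expect ν f = 0) :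
    expect ν (fun ξ => f ξ * heatBath ν f ξ)
      ≤ (S.card - 1 + ε) * expect ν (fun ξ => f ξ ^ 2) := by
  set ρ : ℝ := S.card - 1 + ε
  have hρ : 0 ≤ ρ := by
    have : (1 : ℝ) ≤ S.card := by exact_mod_cast hS.card_pos
    simp only [ρ]; linarith
  obtain ⟨d, hd⟩ := exists_oscBound f
  set u : ℕ → (S → ℤˣ) → ℝ := fun n => (heatBath ν)^[n] f with hu
  have hus : ∀ n, u (n + 1) = heatBath ν (u n) := fun n => Function.iterate_succ_apply' _ _ _
  have hosc : ∀ n, ∃ d', OscBound (u n) d' ∧ ∑ y, d' y ≤ ρ ^ n * ∑ y, d y := by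
    intro n
    induction n with
    | zero => exact ⟨d, hd, by simp⟩
    | succ n ih =>
      obtain ⟨d', hd', hs⟩ := ih
      obtain ⟨e, he, hes⟩ := hd'.exists_heatBath hν hc hc0 hε
      refine ⟨e, hus n ▸ he, hes.trans ?_⟩
      rw [pow_succ', mul_assoc]
      exact mul_le_mul_of_nonneg_left hs hρ
  have hmean : ∀ n, expect ν (u n) = 0 := by
    intro n
    induction n with
    | zero => exact hf
    | succ n ih => rw [hus, expect_heatBath hν, ih, mul_zero]
  have hsq : ∀ h : (S → ℤˣ) → ℝ, 0 ≤ expect ν (fun ξ => h ξ ^ 2) := fun h =>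
    Finset.sum_nonneg fun ξ _ => mul_nonneg (hν ξ).le (sq_nonneg _)
  have key : expect ν (fun ξ => u 1 ξ ^ 2) ≤ ρ ^ 2 * expect ν (fun ξ => u 0 ξ ^ 2) := by
    refine le_mul_of_logConvex (a := fun n => expect ν (fun ξ => u n ξ ^ 2))
      (C := (∑ y, d y) ^ 2) (fun n => hsq _) (fun n => ?_) (sq_nonneg ρ) fun n => ?_
    -- Self-adjointness moves one factor of the heat bath across, and Cauchy–Schwarz then gives
    -- log-convexity.
    · have : expect ν (fun ξ => u (n + 1) ξ ^ 2) = expect ν (fun ξ => u n ξ * u (n + 2) ξ) := by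
        rw [hus (n + 1), ← expect_heatBath_mul hν, ← hus n]
        simp only [sq]
      simp only [this]
      exact expect_mul_sq_le hν _ _
    · obtain ⟨e, he, hes⟩ := hosc n
      rw [← expect_const h1 ((∑ y, d y) ^ 2 * (ρ ^ 2) ^ n)]
      refine expect_mono hν fun ξ => ?_
      have hb := (he.abs_le_sum hν h1 (hmean n) ξ).trans hes
      calc u n ξ ^ 2 = |u n ξ| ^ 2 := (sq_abs _).symm
        _ ≤ (ρ ^ n * ∑ y, d y) ^ 2 := pow_le_pow_left₀ (abs_nonneg _) hb 2
        _ = _ := by rw [mul_pow, ← pow_mul, ← pow_mul, mul_comm n 2, mul_comm]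
  have hcs := expect_mul_sq_le hν f (heatBath ν f)
  have hu1 : u 1 = heatBath ν f := hus 0
  rw [hu1] at key
  have hfin : expect ν (fun ξ => f ξ * heatBath ν f ξ) ^ 2
      ≤ (ρ * expect ν (fun ξ => f ξ ^ 2)) ^ 2 := by
    refine hcs.trans ((mul_le_mul_of_nonneg_left key (hsq f)).trans_eq ?_)
    change _ * (_ * expect ν (fun ξ => f ξ ^ 2)) = _
    ring
  exact (le_abs_self _).trans (abs_le_of_sq_le_sq hfin (mul_nonneg hρ (hsq f)))

theorem expect_siteVariance (hν : ∀ ξ, 0 < ν ξ) (x : S) (f : (S → ℤˣ) → ℝ) :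
    expect ν (siteVariance ν x f)
      = expect ν (fun ξ => f ξ ^ 2) - expect ν (fun ξ => f ξ * siteExpect ν x f ξ) := by
  unfold siteVariance
  rw [expect_sub, expect_siteExpect hν]
  simp only [mul_comm (f _), expect_siteExpect_mul hν x f f, sq]

/-- **Poincaré inequality under Dobrushin's condition**. -/
theorem variance_le_of_influenceBound (hν : ∀ ξ, 0 < ν ξ) (h1 : expect ν (fun _ => 1) = 1)
    {c : S → S → ℝ} (hc : InfluenceBound ν c) {ε : ℝ} (hc0 : ∀ x y, 0 ≤ c x y)
    (hε0 : 0 ≤ ε) (hε : ∀ x, ∑ y, c x y ≤ ε) (f : (S → ℤˣ) → ℝ) :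
    (1 - ε) * variance ν f ≤ ∑ x : S, expect ν (siteVariance ν x f) := by
  -- For empty S the factor |S| - 1 + ε may be negative, so the contraction argument needs a site.
  rcases S.eq_empty_or_nonempty with rfl | hS
  · have hf : f = fun _ => f 1 := funext fun ξ => congrArg f (Subsingleton.elim _ _)
    have : variance ν f = 0 := by
      rw [hf, variance, expect_const h1, expect_const h1, sub_self]
    simp [this]
  set M := expect ν f
  set h : (S → ℤˣ) → ℝ := fun ξ => f ξ - M
  have hh : expect ν h = 0 := by rw [expect_sub, expect_const h1, sub_self]
  have hE : ∀ x ξ, siteExpect ν x h ξ = siteExpect ν x f ξ - M := by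
    intro x ξ
    rw [siteExpect_eq hν, siteExpect_eq hν]
    simp only [h]
    ring
  have hsq : expect ν (fun ξ => h ξ ^ 2) = variance ν f := by
    have : (fun ξ => h ξ ^ 2) = fun ξ => (f ξ ^ 2 - (2 * M) * f ξ) + M ^ 2 := by
      funext ξ; simp only [h]; ring
    rw [this, expect_add, expect_sub, expect_const_mul, expect_const h1, variance]
    ring
  have hV : ∀ x, expect ν (siteVariance ν x f)
      = variance ν f - expect ν (fun ξ => h ξ * siteExpect ν x h ξ) := by
    intro x
    have : (fun ξ => h ξ * siteExpect ν x h ξ) = fun ξ =>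
        (f ξ * siteExpect ν x f ξ - M * f ξ) - (M * siteExpect ν x f ξ - M ^ 2) := by
      funext ξ
      rw [hE]
      simp only [h]
      ring
    rw [this, expect_sub, expect_sub, expect_sub, expect_const_mul, expect_const_mul,
      expect_const h1, expect_siteExpect hν, expect_siteVariance hν, variance]
    ring
  have hmain := expect_mul_heatBath_le hν h1 hc hc0 hε0 hε hS hh
  rw [hsq] at hmain
  have e : expect ν (fun ξ => h ξ * heatBath ν h ξ)
      = ∑ x : S, expect ν (fun ξ => h ξ * siteExpect ν x h ξ) := by
    simp only [heatBath, Finset.mul_sum, expect_sum]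
  rw [e] at hmain
  simp only [hV, Finset.sum_sub_distrib, Finset.sum_const, nsmul_eq_mul, Finset.card_univ,
    Fintype.card_coe]
  linarith

end Dobrushin

/-! ### Energy estimates -/

section Energy

/-- The sign `1` of the edges from `x` to the next level, and `-1` of the others. -/
def levelSign (G : SimpleGraph V) (o x y : V) : ℝ := if G.dist o y = G.dist o x + 1 then 1 else -1

theorem levelSign_add_le (G : SimpleGraph V) (o x y : V) : levelSign G o x y + levelSign G o y x ≤ 0 := by
  unfold levelSign
  split_ifs <;> first | omega | norm_num

theorem edist_eq_dist {G : SimpleGraph V} (hconn : G.Connected) (x y : V) : G.edist x y = (G.dist x y : ℕ∞) :=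
  (hconn x y).coe_dist_eq_edist.symm

variable (G : SimpleGraph V) [G.LocallyFinite]

theorem subset_closure (A : Finset V) : A ⊆ closure G A := by
  classical
  exact Finset.subset_union_left

theorem neighborFinset_subset_closure {A : Finset V} {x : V} (hx : x ∈ A) :
    G.neighborFinset x ⊆ closure G A := by
  classical
  intro y hy
  exact Finset.mem_union_right _ (Finset.mem_biUnion.2 ⟨x, hx, hy⟩)

open Classical in
/-- Exchanging two configurations inside `D` preserves the total energy when they agree on the
outer boundary of `D`. -/
theorem interaction_swap (A D : Finset V) (σ σ' : V → ℤˣ)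
    (h : ∀ x ∈ D, ∀ y ∉ D, G.Adj x y → σ y = σ' y) :
    interaction G A (D.piecewise σ' σ) + interaction G A (D.piecewise σ σ')
      = interaction G A σ + interaction G A σ' := by
  unfold interaction
  rw [← mul_add, ← mul_add]
  congr 1
  rw [← Finset.sum_add_distrib, ← Finset.sum_add_distrib]
  refine Finset.sum_congr rfl fun x _ => ?_
  rw [← Finset.sum_add_distrib, ← Finset.sum_add_distrib]
  refine Finset.sum_congr rfl fun y hy => ?_
  have hxy := (Finset.mem_filter.1 hy).2
  by_cases hx : x ∈ D <;> by_cases hy : y ∈ D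
  · simp only [Finset.piecewise_eq_of_mem, hx, hy]; ring
  · simp only [Finset.piecewise_eq_of_mem, Finset.piecewise_eq_of_notMem, hx, hy,
      not_false_eq_true, h x hx y hy hxy]; ring
  · simp only [Finset.piecewise_eq_of_mem, Finset.piecewise_eq_of_notMem, hx, hy,
      not_false_eq_true, h y hy x hx hxy.symm]; ring
  · simp only [Finset.piecewise_eq_of_notMem, hx, hy, not_false_eq_true]

open Classical in
/-- The energy gained by turning a set of minus spins to plus. -/
theorem interaction_flip {A C : Finset V} (hCA : C ⊆ A) {σ s : V → ℤˣ} (hσ : ∀ v ∈ C, σ v = -1)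
    (hs : ∀ v ∈ C, s v = 1) (hs' : ∀ v ∉ C, s v = σ v) :
    interaction G A s = interaction G A σ
      + 2 * ∑ x ∈ C, ∑ y ∈ G.neighborFinset x \ C, ((σ y : ℤ) : ℝ) := by
  -- Only edges leaving C change: such an edge passes from -σ y to σ y. The sum over ordered pairs
  -- sees it from both ends, which the factor 1 / 2 in `interaction` compensates.
  set a : V → V → ℝ := fun x y => if G.Adj x y ∧ x ∈ C ∧ y ∉ C then ((σ y : ℤ) : ℝ) else 0
    with ha
  have hterm : ∀ x y, (if G.Adj x y then ((s x : ℤ) : ℝ) * ((s y : ℤ) : ℝ) else 0)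
      = (if G.Adj x y then ((σ x : ℤ) : ℝ) * ((σ y : ℤ) : ℝ) else 0) + (2 * a x y + 2 * a y x) := by
    intro x y
    by_cases hxy : G.Adj x y
    · by_cases hx : x ∈ C <;> by_cases hy : y ∈ C <;>
        simp only [ha, hxy, hxy.symm, hx, hy, hσ, hs, hs', and_true, and_false,
          not_true_eq_false, not_false_eq_true, if_true, if_false] <;> push_cast <;> ring
    · have hyx : ¬ G.Adj y x := fun h => hxy h.symm
      simp [ha, hxy, hyx]
  have hsum : ∑ x ∈ closure G A, ∑ y ∈ closure G A, a x y
      = ∑ x ∈ C, ∑ y ∈ G.neighborFinset x \ C, ((σ y : ℤ) : ℝ) := by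
    rw [← Finset.sum_subset (hCA.trans (subset_closure G A))]
    · refine Finset.sum_congr rfl fun x hx => ?_
      rw [← Finset.sum_subset (Finset.sdiff_subset.trans
        (neighborFinset_subset_closure G (hCA hx)) : G.neighborFinset x \ C ⊆ _)]
      · refine Finset.sum_congr rfl fun y hy => ?_
        simp only [Finset.mem_sdiff, SimpleGraph.mem_neighborFinset] at hy
        simp [ha, hx, hy]
      · intro y _ hy
        simp only [Finset.mem_sdiff, SimpleGraph.mem_neighborFinset] at hy
        simp only [ha]
        rw [if_neg]
        tauto
    · intro x _ hx
      simp [ha, hx]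
  have hsum' : ∑ x ∈ closure G A, ∑ y ∈ closure G A, a y x
      = ∑ x ∈ C, ∑ y ∈ G.neighborFinset x \ C, ((σ y : ℤ) : ℝ) := by
    rw [Finset.sum_comm, hsum]
  unfold interaction
  rw [Finset.sum_congr rfl fun x _ => (Finset.sum_filter _ _).trans
    (Finset.sum_congr rfl fun y _ => hterm x y)]
  simp only [Finset.sum_add_distrib, Finset.sum_filter]
  have e : ∀ f : V → V → ℝ, ∑ x ∈ closure G A, ∑ y ∈ closure G A, 2 * f x y
      = 2 * ∑ x ∈ closure G A, ∑ y ∈ closure G A, f x y := by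
    intro f
    simp only [Finset.mul_sum]
  rw [e a, e fun x y => a y x, hsum, hsum']
  ring

/-- The minimal energy gain required from the Peierls argument: turning to plus a set of minus
spins in `F` whose neighbours in `F` are plus gains at least `2` per site. -/
def Peierls (A F : Finset V) (η : V → ℤˣ) : Prop :=
  ∀ (σ : V → ℤˣ) (C : Finset V), C ⊆ F → (∀ v ∉ F, σ v = η v) → (∀ v ∈ C, σ v = -1) →
    (∀ v ∈ C, ∀ w ∈ F, w ∉ C → G.Adj v w → σ w = 1) →
    ∀ s : V → ℤˣ, (∀ v ∈ C, s v = 1) → (∀ v ∉ C, s v = σ v) →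
    interaction G A σ + 2 * C.card ≤ interaction G A s

theorem neg_one_le_spin (u : ℤˣ) : (-1 : ℝ) ≤ ((u : ℤ) : ℝ) := by
  rcases Int.units_eq_one_or u with h | h <;> simp [h]

/-! ### The Peierls estimate in growing graphs. -/

variable {G}

/-- Distances to o change by at most one along an edge, so a neighbour of x outside the next level
lies in the ball of x, and the sum is the difference in the growth condition. -/
theorem IsGrowing.one_le_sum_levelSign {g : ℕ} {o : V} (hG : IsGrowing G g o)
    (hconn : G.Connected) (x : V) : 1 ≤ ∑ y ∈ G.neighborFinset x, levelSign G o x y := by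
  classical
  have hlow := hG.2.2 ⟨G.dist o x, x, (mem_level G o _ x).2 (edist_eq_dist hconn o x), rfl⟩
  have hg : (1 : ℤ) ≤ g := by exact_mod_cast hG.1
  have h1 : (G.neighborFinset x).filter (fun y => G.dist o y = G.dist o x + 1)
      = G.neighborFinset x ∩ level G o (G.dist o x + 1) := by
    ext y
    simp only [Finset.mem_filter, Finset.mem_inter, mem_level, edist_eq_dist hconn]
    norm_cast
  have h2 : (G.neighborFinset x).filter (fun y => ¬ G.dist o y = G.dist o x + 1)
      = G.neighborFinset x ∩ ball G o (G.dist o x) := by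
    ext y
    simp only [Finset.mem_filter, Finset.mem_inter, mem_ball, edist_eq_dist hconn,
      SimpleGraph.mem_neighborFinset, Nat.cast_le]
    refine and_congr_right fun hxy => ?_
    have := hconn.dist_triangle (u := o) (v := x) (w := y)
    rw [SimpleGraph.dist_eq_one_iff_adj.2 hxy] at this
    omega
  unfold levelSign
  rw [Finset.sum_ite, h1, h2]
  simp only [Finset.sum_const, nsmul_eq_mul]
  have : (1 : ℤ) ≤ ((G.neighborFinset x ∩ level G o (G.dist o x + 1)).card : ℤ)
      - ((G.neighborFinset x ∩ ball G o (G.dist o x)).card : ℤ) := by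
    refine hg.trans ?_
    convert hlow
  have h3 : (1 : ℝ) ≤ ((G.neighborFinset x ∩ level G o (G.dist o x + 1)).card : ℝ)
      - ((G.neighborFinset x ∩ ball G o (G.dist o x)).card : ℝ) := by exact_mod_cast this
  linarith

/-- An edge inside C is seen from both ends with total sign at most 0, since at most one end sees
the other in its next level. Discarding such edges can only increase the sum. -/
theorem IsGrowing.card_le_sum_levelSign {g : ℕ} {o : V} [DecidableEq V] (hG : IsGrowing G g o)
    (hconn : G.Connected) (C : Finset V) :
    (C.card : ℝ) ≤ ∑ x ∈ C, ∑ y ∈ G.neighborFinset x \ C, levelSign G o x y := by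
  have h1 : (C.card : ℝ) ≤ ∑ x ∈ C, ∑ y ∈ G.neighborFinset x, levelSign G o x y := by
    simpa using Finset.sum_le_sum fun x (_ : x ∈ C) => hG.one_le_sum_levelSign hconn x
  have h2 : ∑ x ∈ C, ∑ y ∈ G.neighborFinset x ∩ C, levelSign G o x y ≤ 0 := by
    classical
    have e : ∀ x ∈ C, ∑ y ∈ G.neighborFinset x ∩ C, levelSign G o x y
        = ∑ y ∈ C, if G.Adj x y then levelSign G o x y else 0 := by
      intro x _
      rw [← Finset.sum_filter]
      refine Finset.sum_congr ?_ fun _ _ => rfl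
      ext y
      simp [and_comm]
    rw [Finset.sum_congr rfl e]
    have hs := Finset.sum_comm (s := C) (t := C)
      (f := fun x y => if G.Adj x y then levelSign G o x y else 0)
    have hn : ∑ x ∈ C, ∑ y ∈ C, ((if G.Adj x y then levelSign G o x y else 0)
        + if G.Adj y x then levelSign G o y x else 0) ≤ 0 := by
      refine Finset.sum_nonpos fun x _ => Finset.sum_nonpos fun y _ => ?_
      simp only [G.adj_comm y x]
      split_ifs
      · exact levelSign_add_le G o x y
      · simp
    simp only [Finset.sum_add_distrib] at hn
    linarith
  have h3 : ∑ x ∈ C, ∑ y ∈ G.neighborFinset x, levelSign G o x y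
      = ∑ x ∈ C, ∑ y ∈ G.neighborFinset x ∩ C, levelSign G o x y
        + ∑ x ∈ C, ∑ y ∈ G.neighborFinset x \ C, levelSign G o x y := by
    rw [← Finset.sum_add_distrib]
    exact Finset.sum_congr rfl fun x _ => (Finset.sum_inter_add_sum_sdiff _ _ _).symm
  linarith

/-- In a growing graph the Peierls estimate holds for any set of free spins whose sites have all
their neighbours in the next level free or plus. -/
theorem IsGrowing.peierls {g : ℕ} {o : V} (hG : IsGrowing G g o) (hconn : G.Connected)
    {A F : Finset V} (hFA : F ⊆ A) {η : V → ℤˣ}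
    (hη : ∀ x ∈ F, ∀ y ∉ F, G.dist o y = G.dist o x + 1 → η y = 1) : Peierls G A F η := by
  classical
  intro σ C hCF hσ hC hbd s hs hs'
  rw [interaction_flip G (hCF.trans hFA) hC hs hs']
  have := hG.card_le_sum_levelSign hconn C
  have hle : ∑ x ∈ C, ∑ y ∈ G.neighborFinset x \ C, levelSign G o x y
      ≤ ∑ x ∈ C, ∑ y ∈ G.neighborFinset x \ C, ((σ y : ℤ) : ℝ) := by
    -- Neighbours in the next level are plus; the others are taken at their worst value -1, so the
    -- spin dominates `levelSign`.
    refine Finset.sum_le_sum fun x hx => Finset.sum_le_sum fun y hy => ?_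
    simp only [Finset.mem_sdiff, SimpleGraph.mem_neighborFinset] at hy
    unfold levelSign
    split_ifs with h
    · have : σ y = 1 := by
        by_cases hyF : y ∈ F
        · exact hbd x hx y hyF hy.2 hy.1
        · rw [hσ y hyF, hη x (hCF hx) y hyF h]
      simp [this]
    · exact neg_one_le_spin _
  linarith

end Energy

/-! ### Connected sets and clusters -/

section Animals

/-- Every site of `D` can be reached from `x` by a path in `D`. -/
def ReachedFrom (G : SimpleGraph V) (x : V) (D : Finset V) : Prop :=
  ∀ v ∈ D, Relation.ReflTransGen (fun a b => G.Adj a b ∧ b ∈ D) x v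

open Classical in
/-- The connected subsets of `F` that contain `x`. -/
def animals (G : SimpleGraph V) (F : Finset V) (x : V) : Finset (Finset V) :=
  {D ∈ F.powerset | x ∈ D ∧ ReachedFrom G x D}

theorem mem_animals {G : SimpleGraph V} {F : Finset V} {x : V} {D : Finset V} :
    D ∈ animals G F x ↔ D ⊆ F ∧ x ∈ D ∧ ReachedFrom G x D := by
  simp [animals]

open Classical in
/-- The sites of `P` that can be reached from `x` by a path in `P`. -/
def cluster (G : SimpleGraph V) (P : Finset V) (x : V) : Finset V :=
  {v ∈ P | Relation.ReflTransGen (fun a b => G.Adj a b ∧ b ∈ P) x v}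

theorem mem_cluster {G : SimpleGraph V} {P : Finset V} {x v : V} :
    v ∈ cluster G P x ↔ v ∈ P ∧ Relation.ReflTransGen (fun a b => G.Adj a b ∧ b ∈ P) x v := by
  simp [cluster]

theorem cluster_subset (G : SimpleGraph V) (P : Finset V) (x : V) : cluster G P x ⊆ P :=
  fun _ hv => (mem_cluster.1 hv).1

theorem mem_cluster_of_adj {G : SimpleGraph V} {P : Finset V} {x v w : V}
    (hv : v ∈ cluster G P x) (hw : w ∈ P) (hvw : G.Adj v w) : w ∈ cluster G P x :=
  mem_cluster.2 ⟨hw, (mem_cluster.1 hv).2.tail ⟨hvw, hw⟩⟩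

theorem cluster_mem_animals {G : SimpleGraph V} {F P : Finset V} {x : V} (hP : P ⊆ F)
    (hx : x ∈ P) : cluster G P x ∈ animals G F x := by
  refine mem_animals.2 ⟨(cluster_subset G P x).trans hP, mem_cluster.2 ⟨hx, .refl⟩, ?_⟩
  intro v hv
  have h := (mem_cluster.1 hv).2
  clear hv
  induction h with
  | refl => exact .refl
  | tail h1 h2 ih => exact ih.tail ⟨h2.1, mem_cluster.2 ⟨h2.2, h1.tail h2⟩⟩

/-- A connected set is exhausted by a closed walk of length twice the number of its other sites. -/
theorem exists_walk_support [DecidableEq V] {G : SimpleGraph V} {x : V} {D : Finset V} (hx : x ∈ D)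
    (hD : ReachedFrom G x D) :
    ∃ p : G.Walk x x, p.length = 2 * (D.card - 1) ∧ p.support.toFinset = D := by
  have key : ∀ n, n + 1 ≤ D.card → ∃ p : G.Walk x x, p.length = 2 * n ∧
      p.support.toFinset ⊆ D ∧ p.support.toFinset.card = n + 1 := by
    intro n
    induction n with
    | zero => intro _; exact ⟨.nil, by simp, by simpa using hx, by simp⟩
    | succ n ih =>
      intro hn
      obtain ⟨p, hp, hpD, hpc⟩ := ih (by omega)
      obtain ⟨z, hzD, hz⟩ : ∃ z ∈ D, z ∉ p.support.toFinset := by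
        by_contra! hcon
        have := Finset.card_le_card (show D ⊆ p.support.toFinset from hcon)
        omega
      obtain ⟨v, w, hv, hw, hwD, hvw⟩ : ∃ v w, v ∈ p.support ∧ w ∉ p.support ∧ w ∈ D ∧
          G.Adj v w := by
        by_contra! hcon
        have hall : ∀ u, Relation.ReflTransGen (fun a b => G.Adj a b ∧ b ∈ D) x u →
            u ∈ p.support := by
          intro u hu
          induction hu with
          | refl => exact p.start_mem_support
          | tail _ h2 ih =>
            by_contra hno
            exact hcon _ _ ih hno h2.2 h2.1
        exact hz (List.mem_toFinset.2 (hall z (hD z hzD)))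
      -- The detour v, w, v is inserted at a visit to v: two more steps for one new site.
      set q := (p.takeUntil v hv).append (.cons hvw (.cons hvw.symm (p.dropUntil v hv))) with hq
      have hqs : q.support.toFinset = insert w p.support.toFinset := by
        ext u
        have e' : u ∈ p.support ↔ u ∈ (p.takeUntil v hv).support ∨ u ∈ (p.dropUntil v hv).support := by
          rw [← SimpleGraph.Walk.mem_support_append_iff, p.take_spec hv]
        simp only [List.mem_toFinset, Finset.mem_insert, hq, SimpleGraph.Walk.mem_support_append_iff,
          SimpleGraph.Walk.support_cons, List.mem_cons, e']
        constructor
        · rintro (h | rfl | rfl | h)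
          · exact .inr (.inl h)
          · exact .inr (.inl (SimpleGraph.Walk.end_mem_support _))
          · exact .inl rfl
          · exact .inr (.inr h)
        · rintro (rfl | h | h)
          · exact .inr (.inr (.inl rfl))
          · exact .inl h
          · exact .inr (.inr (.inr h))
      refine ⟨q, ?_, ?_, ?_⟩
      · have e := congrArg SimpleGraph.Walk.length (p.take_spec hv)
        simp only [SimpleGraph.Walk.length_append] at e
        simp only [hq, SimpleGraph.Walk.length_append, SimpleGraph.Walk.length_cons]
        omega
      · rw [hqs]
        exact Finset.insert_subset hwD hpD
      · rw [hqs, Finset.card_insert_of_notMem (by simpa using hw), hpc]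
  have hpos : 0 < D.card := Finset.card_pos.2 ⟨x, hx⟩
  obtain ⟨p, hp, hpD, hpc⟩ := key (D.card - 1) (by omega)
  exact ⟨p, hp, Finset.eq_of_subset_of_card_le hpD (by omega)⟩

/-! ### Counting connected sets by walks. -/

variable {G : SimpleGraph V} [G.LocallyFinite]

open Classical in
/-- The supports of the walks of length `n` started at `x`. -/
def walkSupports (G : SimpleGraph V) [G.LocallyFinite] : ℕ → V → Finset (Finset V)
  | 0, x => {{x}}
  | n + 1, x => (G.neighborFinset x).biUnion fun y => (walkSupports G n y).image (insert x)

theorem card_walkSupports_le {Δ : ℕ} (hΔ : ∀ x, G.degree x ≤ Δ) (n : ℕ) (x : V) :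
    (walkSupports G n x).card ≤ Δ ^ n := by
  classical
  induction n generalizing x with
  | zero => simp [walkSupports]
  | succ n ih =>
    unfold walkSupports
    refine (Finset.card_biUnion_le_card_mul _ _ (Δ ^ n)
      fun y _ => Finset.card_image_le.trans (ih y)).trans ?_
    rw [pow_succ']
    exact Nat.mul_le_mul_right _ (hΔ x)

open Classical in
theorem support_mem_walkSupports {x y : V} (p : G.Walk x y) :
    p.support.toFinset ∈ walkSupports G p.length x := by
  induction p with
  | nil => simp [walkSupports]
  | @cons u v w h p ih =>
    simp only [SimpleGraph.Walk.length_cons, walkSupports, Finset.mem_biUnion,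
      SimpleGraph.mem_neighborFinset]
    refine ⟨v, h, Finset.mem_image.2 ⟨_, ih, ?_⟩⟩
    rw [SimpleGraph.Walk.support_cons, List.toFinset_cons]

theorem card_animals_le {Δ : ℕ} (hΔ : ∀ x, G.degree x ≤ Δ) (F : Finset V) (x : V) (n : ℕ) :
    ((animals G F x).filter fun D => D.card = n).card ≤ Δ ^ (2 * (n - 1)) := by
  classical
  refine (Finset.card_le_card ?_).trans (card_walkSupports_le hΔ (2 * (n - 1)) x)
  intro D hD
  obtain ⟨hD, hn⟩ := Finset.mem_filter.1 hD
  obtain ⟨-, hx, hr⟩ := mem_animals.1 hD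
  obtain ⟨p, hp, hps⟩ := exists_walk_support hx hr
  rw [← hps, ← hn, ← hp]
  exact support_mem_walkSupports p

/-- Grouping by cardinality and weakening the count to Δ ^ (2 * n) gives a geometric series of ratio
t = Δ² r, and t / (1 - t) ≤ 2 t for t ≤ 1 / 2. -/
theorem sum_animals_pow_le {Δ : ℕ} (hΔ : ∀ x, G.degree x ≤ Δ) (hΔ1 : 1 ≤ Δ) (F : Finset V) (x : V)
    {r : ℝ} (hr : 0 ≤ r) (hr1 : Δ ^ 2 * r ≤ 1 / 2) :
    ∑ D ∈ animals G F x, r ^ D.card ≤ 2 * (Δ ^ 2 * r) := by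
  classical
  have hmaps : ∀ D ∈ animals G F x, D.card ∈ Finset.Ico 1 (F.card + 1) := by
    intro D hD
    obtain ⟨hDF, hx, -⟩ := mem_animals.1 hD
    have := Finset.card_le_card hDF
    have : 0 < D.card := Finset.card_pos.2 ⟨x, hx⟩
    simp only [Finset.mem_Ico]
    omega
  rw [← Finset.sum_fiberwise_of_maps_to hmaps]
  have h1 : ∀ n, ∑ D ∈ animals G F x with D.card = n, r ^ D.card ≤ (Δ ^ 2 * r) ^ n := by
    intro n
    rw [Finset.sum_congr rfl (g := fun _ => r ^ n) fun D hD => by rw [(Finset.mem_filter.1 hD).2],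
      Finset.sum_const, nsmul_eq_mul, mul_pow]
    refine mul_le_mul_of_nonneg_right ?_ (pow_nonneg hr n)
    rw [← pow_mul]
    have h2 := (card_animals_le hΔ F x n).trans (Nat.pow_le_pow_right hΔ1 (show 2 * (n - 1) ≤ 2 * n by omega))
    exact_mod_cast h2
  refine (Finset.sum_le_sum fun n _ => h1 n).trans ?_
  set t : ℝ := Δ ^ 2 * r
  have ht : 0 ≤ t := by positivity
  have hgeo := geom_sum_Ico_le_of_lt_one (m := 1) (n := F.card + 1) ht (by linarith)
  refine hgeo.trans ?_
  rw [pow_one, div_le_iff₀ (by linarith)]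
  nlinarith

open Classical in
-- Exchanging the sums, D is counted once for each adjacent y, at most |D| Δ ≤ (2 Δ)^|D| times; this
-- factor is absorbed into the weight per site.
theorem sum_sum_animals_le {Δ : ℕ} (hΔ : ∀ x, G.degree x ≤ Δ) (hΔ1 : 1 ≤ Δ) (F S : Finset V) (x : V)
    {q : ℝ} (hq : 0 ≤ q) (hq1 : 2 * Δ ^ 3 * q ≤ 1 / 2) :
    ∑ y ∈ S, ∑ D ∈ animals G F x with ∃ v ∈ D, G.Adj v y, q ^ D.card ≤ 4 * Δ ^ 3 * q := by
  have hΔr : (1 : ℝ) ≤ Δ := by exact_mod_cast hΔ1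
  simp only [Finset.sum_filter]
  rw [Finset.sum_comm]
  have h1 : ∀ D ∈ animals G F x, (∑ y ∈ S, if ∃ v ∈ D, G.Adj v y then q ^ D.card else 0)
      ≤ (2 * Δ * q) ^ D.card := by
    intro D hD
    rw [← Finset.sum_filter, Finset.sum_const, nsmul_eq_mul, mul_pow]
    refine mul_le_mul_of_nonneg_right ?_ (pow_nonneg hq _)
    have hsub : S.filter (fun y => ∃ v ∈ D, G.Adj v y) ⊆ D.biUnion fun v => G.neighborFinset v := by
      intro y hy
      obtain ⟨v, hv, hvy⟩ := (Finset.mem_filter.1 hy).2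
      exact Finset.mem_biUnion.2 ⟨v, hv, by simpa using hvy⟩
    have hcard : (S.filter (fun y => ∃ v ∈ D, G.Adj v y)).card ≤ D.card * Δ :=
      (Finset.card_le_card hsub).trans (Finset.card_biUnion_le_card_mul _ _ _ fun v _ => hΔ v)
    have hpos : D.card ≠ 0 := (Finset.card_pos.2 ⟨x, (mem_animals.1 hD).2.1⟩).ne'
    have h3 : D.card * Δ ≤ 2 ^ D.card * Δ ^ D.card :=
      Nat.mul_le_mul Nat.lt_two_pow_self.le (Nat.le_self_pow hpos _)
    rw [mul_pow]
    exact_mod_cast hcard.trans h3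
  refine (Finset.sum_le_sum h1).trans ((sum_animals_pow_le hΔ hΔ1 F x (by positivity) ?_).trans_eq ?_)
  · calc (Δ : ℝ) ^ 2 * (2 * Δ * q) = 2 * Δ ^ 3 * q := by ring
      _ ≤ _ := hq1
  · ring

end Animals

/-! ### Comparison of two boundary conditions -/

section TwoReplicas

open Classical in
/-- The configurations that agree with `η` outside `F`, as a finset. -/
def confs (F : Finset V) (η : V → ℤˣ) : Finset (V → ℤˣ) :=
  (Finset.univ : Finset (Config F η)).image Subtype.val

theorem mem_confs {F : Finset V} {η σ : V → ℤˣ} : σ ∈ confs F η ↔ ∀ x ∉ F, σ x = η x := by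
  simp [confs]

variable {G : SimpleGraph V} [G.LocallyFinite]

/-- The Boltzmann weight. -/
def weight (G : SimpleGraph V) [G.LocallyFinite] (β : ℝ) (A : Finset V) (σ : V → ℤˣ) : ℝ :=
  Real.exp (β * interaction G A σ)

theorem weight_pos (β : ℝ) (A : Finset V) (σ : V → ℤˣ) : 0 < weight G β A σ := Real.exp_pos _

/-- The sites of `F` where the two configurations are not both plus. -/
def nonplus (F : Finset V) (p : (V → ℤˣ) × (V → ℤˣ)) : Finset V :=
  {v ∈ F | p.1 v = -1 ∨ p.2 v = -1}

open Classical in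
-- Peierls argument for two replicas: all spins in D are turned to plus in both. Sites of F
-- bordering D are plus in both replicas, so the energy estimate applies to each. The original pair
-- is recovered from the two sets of erased minus spins, hence at most 4^|D| preimages.
theorem sum_weight_cluster_le {A F : Finset V} {β : ℝ} (hβ : 0 ≤ β) {η η' : V → ℤˣ}
    (hη : Peierls G A F η) (hη' : Peierls G A F η') (x : V) (D : Finset V) :
    ∑ p ∈ confs F η ×ˢ confs F η' with cluster G (nonplus F p) x = D,
        weight G β A p.1 * weight G β A p.2
      ≤ (4 * Real.exp (-2 * β)) ^ D.card *
        ((∑ σ ∈ confs F η, weight G β A σ) * ∑ σ ∈ confs F η', weight G β A σ) := by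
  set up : (V → ℤˣ) → V → ℤˣ := fun σ v => if v ∈ D then 1 else σ v with hup
  set mi : (V → ℤˣ) → Finset V := fun σ => D.filter fun v => σ v = -1 with hmi
  have hgain : ∀ {η : V → ℤˣ}, Peierls G A F η → ∀ σ ∈ confs F η, D ⊆ F →
      (∀ v ∈ D, ∀ w ∈ F, w ∉ D → G.Adj v w → σ w = 1) →
      weight G β A σ ≤ Real.exp (-2 * β) ^ (mi σ).card * weight G β A (up σ) := by
    intro η hη σ hσ hDF hbd
    have := hη σ (mi σ) ((Finset.filter_subset _ _).trans hDF) (mem_confs.1 hσ)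
      (fun v hv => (Finset.mem_filter.1 hv).2) ?_ (up σ) ?_ ?_
    · unfold weight
      rw [← Real.exp_nat_mul, ← Real.exp_add, Real.exp_le_exp]
      nlinarith
    · intro v hv w hw hwC hvw
      by_cases hwD : w ∈ D
      · refine (Int.units_eq_one_or (σ w)).resolve_right fun h => hwC ?_
        exact Finset.mem_filter.2 ⟨hwD, h⟩
      · exact hbd v (Finset.mem_filter.1 hv).1 w hw hwD hvw
    · intro v hv
      simp [hup, (Finset.mem_filter.1 hv).1]
    · intro v hv
      by_cases hvD : v ∈ D
      · have h1 : σ v = 1 := (Int.units_eq_one_or (σ v)).resolve_right fun h =>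
          hv (Finset.mem_filter.2 ⟨hvD, h⟩)
        simp [hup, h1]
      · simp [hup, hvD]
  have hupm : ∀ {η σ : V → ℤˣ}, D ⊆ F → σ ∈ confs F η → up σ ∈ confs F η := by
    intro η σ hDF hσ
    refine mem_confs.2 fun v hv => ?_
    have : v ∉ D := fun h => hv (hDF h)
    simp [hup, this, mem_confs.1 hσ v hv]
  have hrec : ∀ {σ σ' : V → ℤˣ}, mi σ = mi σ' → up σ = up σ' → σ = σ' := by
    intro σ σ' h1 h2
    funext v
    by_cases hv : v ∈ D
    · have h3 : v ∈ mi σ ↔ v ∈ mi σ' := by rw [h1]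
      simp only [hmi, Finset.mem_filter, hv, true_and] at h3
      rcases Int.units_eq_one_or (σ v) with h | h <;> rcases Int.units_eq_one_or (σ' v) with h' | h' <;>
        simp_all
    · have := congrFun h2 v
      simpa [hup, hv] using this
  set P := (confs F η ×ˢ confs F η').filter fun p => cluster G (nonplus F p) x = D with hP
  set Φ : (V → ℤˣ) × (V → ℤˣ) → (Finset V × Finset V) × ((V → ℤˣ) × (V → ℤˣ)) :=
    fun p => ((mi p.1, mi p.2), (up p.1, up p.2)) with hΦ
  have hprop : ∀ p ∈ P, p.1 ∈ confs F η ∧ p.2 ∈ confs F η' ∧ D ⊆ nonplus F p ∧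
      (∀ v ∈ D, ∀ w ∈ F, w ∉ D → G.Adj v w → p.1 w = 1 ∧ p.2 w = 1) := by
    intro p hp
    obtain ⟨hp, hD⟩ := Finset.mem_filter.1 hp
    obtain ⟨h1, h2⟩ := Finset.mem_product.1 hp
    refine ⟨h1, h2, hD ▸ cluster_subset _ _ _, fun v hv w hw hwD hvw => ?_⟩
    have hwn : w ∉ nonplus F p := fun h => hwD (hD ▸ mem_cluster_of_adj (hD.symm ▸ hv) h hvw)
    simp only [nonplus, Finset.mem_filter, hw, true_and, not_or] at hwn
    exact ⟨(Int.units_eq_one_or _).resolve_right hwn.1, (Int.units_eq_one_or _).resolve_right hwn.2⟩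
  have hterm : ∀ p ∈ P, weight G β A p.1 * weight G β A p.2
      ≤ Real.exp (-2 * β) ^ D.card * (weight G β A (Φ p).2.1 * weight G β A (Φ p).2.2) := by
    intro p hp
    obtain ⟨h1, h2, hDn, hbd⟩ := hprop p hp
    have hDF : D ⊆ F := hDn.trans (Finset.filter_subset _ _)
    have g1 := hgain hη p.1 h1 hDF fun v hv w hw hwD hvw => (hbd v hv w hw hwD hvw).1
    have g2 := hgain hη' p.2 h2 hDF fun v hv w hw hwD hvw => (hbd v hv w hw hwD hvw).2
    -- Each site of D is minus in at least one replica, so the two gains together pay for all of D.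
    have hcard : D.card ≤ (mi p.1).card + (mi p.2).card := by
      refine (Finset.card_le_card fun v hv => ?_).trans (Finset.card_union_le _ _)
      have := (Finset.mem_filter.1 (hDn hv)).2
      simp only [hmi, Finset.mem_union, Finset.mem_filter, hv, true_and]
      exact this
    have hpow : Real.exp (-2 * β) ^ ((mi p.1).card + (mi p.2).card) ≤ Real.exp (-2 * β) ^ D.card :=
      pow_le_pow_of_le_one (Real.exp_pos _).le (Real.exp_le_one_iff.2 (by linarith)) hcard
    calc weight G β A p.1 * weight G β A p.2
        ≤ (Real.exp (-2 * β) ^ (mi p.1).card * weight G β A (up p.1)) *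
          (Real.exp (-2 * β) ^ (mi p.2).card * weight G β A (up p.2)) :=
          mul_le_mul g1 g2 (weight_pos _ _ _).le
            (mul_nonneg (pow_nonneg (Real.exp_pos _).le _) (weight_pos _ _ _).le)
      _ = Real.exp (-2 * β) ^ ((mi p.1).card + (mi p.2).card) *
          (weight G β A (up p.1) * weight G β A (up p.2)) := by rw [pow_add]; ring
      _ ≤ _ := mul_le_mul_of_nonneg_right hpow
          (mul_pos (weight_pos _ _ _) (weight_pos _ _ _)).le
  have hinj : Set.InjOn Φ P := by
    intro p _ p' _ h
    simp only [hΦ, Prod.mk.injEq] at h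
    exact Prod.ext (hrec h.1.1 h.2.1) (hrec h.1.2 h.2.2)
  have himg : P.image Φ ⊆ (D.powerset ×ˢ D.powerset) ×ˢ (confs F η ×ˢ confs F η') := by
    intro t ht
    obtain ⟨p, hp, rfl⟩ := Finset.mem_image.1 ht
    obtain ⟨h1, h2, hDn, -⟩ := hprop p hp
    have hDF : D ⊆ F := hDn.trans (Finset.filter_subset _ _)
    simp only [hΦ, Finset.mem_product, Finset.mem_powerset]
    exact ⟨⟨Finset.filter_subset _ _, Finset.filter_subset _ _⟩, hupm hDF h1, hupm hDF h2⟩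
  refine (Finset.sum_le_sum hterm).trans ?_
  rw [← Finset.mul_sum, ← Finset.sum_image (f := fun t : (Finset V × Finset V) ×
    ((V → ℤˣ) × (V → ℤˣ)) => weight G β A t.2.1 * weight G β A t.2.2) hinj]
  refine (mul_le_mul_of_nonneg_left (Finset.sum_le_sum_of_subset_of_nonneg himg fun t _ _ =>
    (mul_pos (weight_pos _ _ _) (weight_pos _ _ _)).le) (pow_nonneg (Real.exp_pos _).le _)).trans_eq ?_
  rw [Finset.sum_product]
  dsimp only
  rw [Finset.sum_const, Finset.card_product, Finset.card_powerset, nsmul_eq_mul,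
    Finset.sum_mul_sum, ← Finset.sum_product', mul_pow, show (4 : ℝ) = 2 * 2 by norm_num, mul_pow]
  push_cast
  ring

theorem piecewise_swap_apply [DecidableEq V] (D : Finset V) (σ σ' : V → ℤˣ) (v : V) :
    (D.piecewise σ' σ v = σ v ∧ D.piecewise σ σ' v = σ' v) ∨
      (D.piecewise σ' σ v = σ' v ∧ D.piecewise σ σ' v = σ v) := by
  by_cases h : v ∈ D <;> simp [h]

open Classical in
/-- The influence on the spin at `x` of a change of the boundary condition at `y` is bounded by the
probability that a cluster of non-plus spins of two independent replicas joins `x` to `y`. -/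
theorem abs_minusProb_sub_le {A F : Finset V} {β : ℝ} (hβ : 0 ≤ β) {η η' : V → ℤˣ}
    (hη : Peierls G A F η) (hη' : Peierls G A F η') {x y : V} (hx : x ∈ F)
    (hηη' : ∀ v ∉ F, v ≠ y → η v = η' v) :
    |(∑ σ ∈ confs F η with σ x = -1, weight G β A σ) / (∑ σ ∈ confs F η, weight G β A σ)
      - (∑ σ ∈ confs F η' with σ x = -1, weight G β A σ) / (∑ σ ∈ confs F η', weight G β A σ)|
    ≤ ∑ D ∈ animals G F x with ∃ v ∈ D, G.Adj v y, (4 * Real.exp (-2 * β)) ^ D.card := by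
  have hZ : ∀ η : V → ℤˣ, 0 < ∑ σ ∈ confs F η, weight G β A σ := fun η =>
    Finset.sum_pos (fun _ _ => weight_pos _ _ _) ⟨η, mem_confs.2 fun _ _ => rfl⟩
  set Z := ∑ σ ∈ confs F η, weight G β A σ
  set Z' := ∑ σ ∈ confs F η', weight G β A σ
  have hZpos : 0 < Z := hZ η
  have hZpos' : 0 < Z' := hZ η'
  set ind : (V → ℤˣ) → ℝ := fun σ => if σ x = -1 then 1 else 0 with hind
  set t : (V → ℤˣ) × (V → ℤˣ) → ℝ := fun p =>
    weight G β A p.1 * weight G β A p.2 * (ind p.1 - ind p.2) with ht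
  set cl : (V → ℤˣ) × (V → ℤˣ) → Finset V := fun p => cluster G (nonplus F p) x with hcl
  set pairs := confs F η ×ˢ confs F η' with hpairs
  have hnum : (∑ σ ∈ confs F η with σ x = -1, weight G β A σ) * Z'
      - Z * (∑ σ ∈ confs F η' with σ x = -1, weight G β A σ) = ∑ p ∈ pairs, t p := by
    rw [Finset.sum_filter, Finset.sum_filter, Finset.sum_mul_sum, Finset.sum_mul_sum,
      ← Finset.sum_product', ← Finset.sum_product', ← Finset.sum_sub_distrib]
    refine Finset.sum_congr rfl fun p _ => ?_
    simp only [ht, hind]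
    split_ifs <;> ring
  have hgood : ∑ p ∈ pairs with ¬ ∃ v ∈ cl p, G.Adj v y, t p = 0 := by
    -- Exchanging the replicas inside the cluster leaves the cluster unchanged, preserves the
    -- product weight because the replicas agree on its outer boundary, and reverses the sign of
    -- `t`.
    set sw : (V → ℤˣ) × (V → ℤˣ) → (V → ℤˣ) × (V → ℤˣ) := fun p =>
      ((cl p).piecewise p.2 p.1, (cl p).piecewise p.1 p.2) with hsw
    have hnp : ∀ p, nonplus F (sw p) = nonplus F p := by
      intro p
      refine Finset.filter_congr fun v _ => ?_
      rcases piecewise_swap_apply (cl p) p.1 p.2 v with h | h <;> simp only [hsw, h.1, h.2]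
      exact or_comm
    have hclsw : ∀ p, cl (sw p) = cl p := fun p => by simp only [hcl, hnp]
    have hneg : ∀ p ∈ pairs, (¬ ∃ v ∈ cl p, G.Adj v y) → t p + t (sw p) = 0 := by
      intro p hp hgood
      obtain ⟨h1, h2⟩ := Finset.mem_product.1 hp
      have hw : weight G β A (sw p).1 * weight G β A (sw p).2
          = weight G β A p.1 * weight G β A p.2 := by
        simp only [weight, ← Real.exp_add, ← mul_add, hsw]
        rw [interaction_swap G A (cl p) p.1 p.2]
        intro v hv w hw hvw
        by_cases hwF : w ∈ F
        · have hwn : w ∉ nonplus F p := fun h => hw (mem_cluster_of_adj hv h hvw)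
          simp only [nonplus, Finset.mem_filter, hwF, true_and, not_or] at hwn
          rw [(Int.units_eq_one_or _).resolve_right hwn.1,
            (Int.units_eq_one_or _).resolve_right hwn.2]
        · rw [mem_confs.1 h1 w hwF, mem_confs.1 h2 w hwF]
          refine hηη' w hwF ?_
          rintro rfl
          exact hgood ⟨v, hv, hvw⟩
      have hi : ind (sw p).1 - ind (sw p).2 = -(ind p.1 - ind p.2) := by
        by_cases hxc : x ∈ cl p
        · simp [hind, hsw, hxc]
        · have hxn : x ∉ nonplus F p := fun h => hxc (mem_cluster.2 ⟨h, .refl⟩)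
          simp only [nonplus, Finset.mem_filter, hx, true_and, not_or] at hxn
          simp [hind, hsw, hxc, hxn.1, hxn.2]
      simp only [ht]
      rw [hw, hi]
      ring
    refine Finset.sum_involution (fun p _ => sw p) ?_ ?_ ?_ ?_
    · intro p hp
      obtain ⟨hp, hg⟩ := Finset.mem_filter.1 hp
      exact hneg p hp hg
    · intro p hp h0 heq
      obtain ⟨hp, hg⟩ := Finset.mem_filter.1 hp
      have := hneg p hp hg
      rw [heq] at this
      exact h0 (by linarith)
    · intro p hp
      obtain ⟨hp, hg⟩ := Finset.mem_filter.1 hp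
      obtain ⟨h1, h2⟩ := Finset.mem_product.1 hp
      refine Finset.mem_filter.2 ⟨Finset.mem_product.2 ⟨?_, ?_⟩, by rwa [hclsw]⟩
      all_goals
        refine mem_confs.2 fun v hv => ?_
        have hvc : v ∉ cl p := fun h =>
          hv (Finset.mem_filter.1 (cluster_subset G (nonplus F p) x h)).1
        simp only [hsw, Finset.piecewise_eq_of_notMem _ _ _ hvc]
      · exact mem_confs.1 h1 v hv
      · exact mem_confs.1 h2 v hv
    · intro p _
      simp only [hsw]
      rw [show cl ((cl p).piecewise p.2 p.1, (cl p).piecewise p.1 p.2) = cl p from hclsw p]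
      ext v <;> by_cases hv : v ∈ cl p <;> simp [hv]
  have hbad : |∑ p ∈ pairs with ∃ v ∈ cl p, G.Adj v y, t p|
      ≤ ∑ D ∈ animals G F x with ∃ v ∈ D, G.Adj v y, (4 * Real.exp (-2 * β)) ^ D.card * (Z * Z') := by
    -- If x is plus in both replicas the two indicators cancel, so only pairs with x in its own
    -- cluster contribute.
    have h1 : ∀ p, |t p| ≤ if x ∈ nonplus F p then weight G β A p.1 * weight G β A p.2 else 0 := by
      intro p
      have hw : 0 < weight G β A p.1 * weight G β A p.2 := mul_pos (weight_pos _ _ _) (weight_pos _ _ _)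
      simp only [ht, hind, abs_mul, abs_of_pos (weight_pos (G := G) β A _), nonplus,
        Finset.mem_filter, hx, true_and]
      by_cases ha : p.1 x = -1 <;> by_cases hb : p.2 x = -1 <;> simp [ha, hb, hw.le]
    refine (Finset.abs_sum_le_sum_abs _ _).trans ((Finset.sum_le_sum fun p _ => h1 p).trans ?_)
    rw [← Finset.sum_filter, Finset.filter_filter]
    have hmaps : ∀ p ∈ pairs.filter (fun p => (∃ v ∈ cl p, G.Adj v y) ∧ x ∈ nonplus F p),
        cl p ∈ (animals G F x).filter fun D => ∃ v ∈ D, G.Adj v y := by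
      intro p hp
      obtain ⟨-, hy, hxn⟩ := Finset.mem_filter.1 hp
      exact Finset.mem_filter.2 ⟨cluster_mem_animals (Finset.filter_subset _ _) hxn, hy⟩
    rw [← Finset.sum_fiberwise_of_maps_to hmaps]
    refine Finset.sum_le_sum fun D _ => ?_
    refine le_trans ?_ (sum_weight_cluster_le hβ hη hη' x D)
    refine Finset.sum_le_sum_of_subset_of_nonneg ?_ fun p _ _ =>
      (mul_pos (weight_pos _ _ _) (weight_pos _ _ _)).le
    intro p hp
    obtain ⟨hp, hD⟩ := Finset.mem_filter.1 hp
    exact Finset.mem_filter.2 ⟨(Finset.mem_filter.1 hp).1, hD⟩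
  rw [div_sub_div _ _ hZpos.ne' hZpos'.ne', hnum, abs_div, abs_of_pos (mul_pos hZpos hZpos'),
    div_le_iff₀ (mul_pos hZpos hZpos'), Finset.sum_mul,
    ← Finset.sum_filter_add_sum_filter_not pairs (fun p => ∃ v ∈ cl p, G.Adj v y), hgood, add_zero]
  exact hbad

end TwoReplicas

/-! ### The conditional measures on a level -/

section Marginal

variable {G : SimpleGraph V} [G.LocallyFinite] {β : ℝ} {o : V} {m i : ℕ} {S : Finset V}
  {τ : PlusConfig G o m}

open Classical in
/-- The unnormalized version of `marginal`. -/
def marginalWeight (G : SimpleGraph V) [G.LocallyFinite] (β : ℝ) (o : V) (m i : ℕ) (S : Finset V)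
    (τ : PlusConfig G o m) (ξ : S → ℤˣ) : ℝ :=
  ∑ η : PlusConfig G o m with
    (∀ x : S, η.1 x = ξ x) ∧ ∀ x ∈ ball G o i, x ∉ S → η.1 x = τ.1 x,
    weight G β (ball G o m) η.1

open Classical in
/-- The configuration equal to `ξ` on `S` and to `τ` elsewhere. -/
def background (τ : V → ℤˣ) (ξ : S → ℤˣ) (v : V) : ℤˣ :=
  if h : v ∈ S then ξ ⟨v, h⟩ else τ v

theorem marginalWeight_pos (hSm : S ⊆ ball G o m) (ξ : S → ℤˣ) :
    0 < marginalWeight G β o m i S τ ξ := by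
  classical
  refine Finset.sum_pos (fun _ _ => weight_pos _ _ _) ⟨⟨background τ.1 ξ, fun v hv => ?_⟩, ?_⟩
  · have : v ∉ S := fun h => hv (hSm h)
    simp [background, this, τ.2 v hv]
  · refine Finset.mem_filter.2 ⟨Finset.mem_univ _, fun v => by simp [background], fun v _ hv => ?_⟩
    simp [background, hv]

open Classical in
theorem sum_marginalWeight :
    ∑ ξ : S → ℤˣ, marginalWeight G β o m i S τ ξ =
      ∑ η : PlusConfig G o m with ∀ x ∈ ball G o i, x ∉ S → η.1 x = τ.1 x,
        weight G β (ball G o m) η.1 := by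
  unfold marginalWeight
  rw [← Finset.sum_fiberwise_of_maps_to (t := Finset.univ)
    (g := fun (η : PlusConfig G o m) (x : S) => η.1 x) fun _ _ => Finset.mem_univ _]
  refine Finset.sum_congr rfl fun ξ _ => Finset.sum_congr ?_ fun _ _ => rfl
  ext η
  simp only [Finset.mem_filter, Finset.mem_univ, true_and, funext_iff]
  exact and_comm

open Classical in
-- The partition function of μ cancels in the conditioning, so unnormalized weights suffice.
theorem marginal_eq (ξ : S → ℤˣ) :
    marginal G β o m i S τ ξ =
      marginalWeight G β o m i S τ ξ / ∑ ζ : S → ℤˣ, marginalWeight G β o m i S τ ζ := by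
  have hZ : ∑ σ' : PlusConfig G o m, Real.exp (β * interaction G (ball G o m) σ'.1) ≠ 0 :=
    (Finset.sum_pos (fun _ _ => Real.exp_pos _) ⟨τ, Finset.mem_univ _⟩).ne'
  rw [sum_marginalWeight]
  unfold marginal marginalWeight plusGibbs gibbs weight
  rw [← Finset.sum_div, ← Finset.sum_div, div_div_div_cancel_right₀ hZ]

open Classical in
theorem sum_marginalWeight_pos (hSm : S ⊆ ball G o m) :
    0 < ∑ ζ : S → ℤˣ, marginalWeight G β o m i S τ ζ :=
  Finset.sum_pos (fun _ _ => marginalWeight_pos hSm _) Finset.univ_nonempty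

theorem marginal_pos (hSm : S ⊆ ball G o m) (ξ : S → ℤˣ) : 0 < marginal G β o m i S τ ξ := by
  rw [marginal_eq]
  exact div_pos (marginalWeight_pos hSm _) (sum_marginalWeight_pos hSm)

theorem expect_marginal_one (hSm : S ⊆ ball G o m) :
    expect (marginal G β o m i S τ) (fun _ => 1) = 1 := by
  unfold expect
  simp only [mul_one, marginal_eq]
  rw [← Finset.sum_div]
  exact div_self (sum_marginalWeight_pos hSm).ne'

/-! ### One-site conditional laws and their influences. -/

open Classical in
/-- The sites whose spin remains random when all of `B_i` except `x` is fixed. -/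
def freeSites (G : SimpleGraph V) [G.LocallyFinite] (o : V) (m i : ℕ) (x : V) : Finset V :=
  insert x (ball G o m \ ball G o i)

theorem mem_freeSites {x v : V} :
    v ∈ freeSites G o m i x ↔ v = x ∨ (v ∈ ball G o m ∧ v ∉ ball G o i) := by
  simp [freeSites]

theorem ball_mono (him : i ≤ m) : ball G o i ⊆ ball G o m := by
  intro v hv
  rw [mem_ball] at hv ⊢
  exact hv.trans (by exact_mod_cast him)

theorem level_subset_ball : level G o i ⊆ ball G o i := by
  intro v hv
  rw [mem_level] at hv
  exact (mem_ball G o i v).2 hv.le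

open Classical in
-- Once the other spins of S are given, all of B_i except x is fixed, and summing over the remaining
-- spins is a sum over configurations on `freeSites` with boundary condition `background`.
theorem marginalWeight_update (him : i ≤ m) (hS : S ⊆ ball G o i) (x : S) (ξ : S → ℤˣ) (a : ℤˣ) :
    marginalWeight G β o m i S τ (Function.update ξ x a) =
      ∑ σ ∈ confs (freeSites G o m i x) (background τ.1 ξ) with σ x = a,
        weight G β (ball G o m) σ := by
  unfold marginalWeight
  refine Finset.sum_bij (fun η _ => η.1) ?_ (fun _ _ _ _ h => Subtype.ext h) ?_ fun _ _ => rfl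
  · intro η hη
    obtain ⟨-, h1, h2⟩ := Finset.mem_filter.1 hη
    refine Finset.mem_filter.2 ⟨mem_confs.2 fun v hv => ?_, by simpa using h1 x⟩
    rw [mem_freeSites, not_or, not_and, not_not] at hv
    by_cases hvS : v ∈ S
    · have hne : (⟨v, hvS⟩ : S) ≠ x := fun h => hv.1 (congrArg Subtype.val h)
      have := h1 ⟨v, hvS⟩
      rw [Function.update_of_ne hne] at this
      simpa [background, hvS] using this
    · simp only [background, hvS, dif_neg, not_false_eq_true]
      by_cases hvm : v ∈ ball G o m
      · exact h2 v (hv.2 hvm) hvS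
      · rw [η.2 v hvm, τ.2 v hvm]
  · intro σ hσ
    obtain ⟨hσ, hσx⟩ := Finset.mem_filter.1 hσ
    have hσ' := mem_confs.1 hσ
    have hxi : x.1 ∈ ball G o i := hS x.2
    refine ⟨⟨σ, fun v hv => ?_⟩, Finset.mem_filter.2 ⟨Finset.mem_univ _, fun v => ?_, fun v hv hvS => ?_⟩, rfl⟩
    · have hvi : v ∉ ball G o i := fun h => hv (ball_mono him h)
      have hvS : v ∉ S := fun h => hvi (hS h)
      rw [hσ' v ?_]
      · simp [background, hvS, τ.2 v hv]
      · rw [mem_freeSites]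
        rintro (rfl | h)
        · exact hvi hxi
        · exact hv h.1
    · by_cases hvx : v = x
      · subst hvx
        simpa using hσx
      · rw [Function.update_of_ne hvx]
        change σ v = ξ v
        rw [hσ' v ?_]
        · simp [background]
        · rw [mem_freeSites]
          rintro (h | h)
          · exact hvx (Subtype.ext h)
          · exact h.2 (hS v.2)
    · change σ v = τ.1 v
      rw [hσ' v ?_]
      · simp [background, hvS]
      · rw [mem_freeSites]
        rintro (rfl | h)
        · exact hvS x.2
        · exact h.2 hv

open Classical in
theorem minusProb_marginal (him : i ≤ m) (hS : S ⊆ ball G o i) (x : S) (ξ : S → ℤˣ) :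
    minusProb (marginal G β o m i S τ) x ξ =
      (∑ σ ∈ confs (freeSites G o m i x) (background τ.1 ξ) with σ x = -1,
        weight G β (ball G o m) σ) /
      ∑ σ ∈ confs (freeSites G o m i x) (background τ.1 ξ), weight G β (ball G o m) σ := by
  unfold minusProb
  simp only [marginal_eq]
  rw [← Finset.sum_div,
    div_div_div_cancel_right₀ (sum_marginalWeight_pos (hS.trans (ball_mono him))).ne']
  simp only [marginalWeight_update him hS]
  rw [Finset.sum_fiberwise_of_maps_to (g := fun σ : V → ℤˣ => σ x) fun _ _ => Finset.mem_univ _]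

/-- Free sites are at distance at least i from o, so their neighbours in the next level lie outside
B_i: these are free, or outside B_m and plus. The fixed spins in B_i are never above a free site and
may be arbitrary. -/
theorem peierls_freeSites {g : ℕ} (hG : IsGrowing G g o) (hconn : G.Connected) (him : i ≤ m)
    (hS : S ⊆ level G o i) {x : V} (hx : x ∈ S) (ξ : S → ℤˣ) :
    Peierls G (ball G o m) (freeSites G o m i x) (background τ.1 ξ) := by
  have hxi := (mem_level G o i x).1 (hS hx)
  have hFm : freeSites G o m i x ⊆ ball G o m := by
    intro v hv
    rcases mem_freeSites.1 hv with rfl | h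
    · exact ball_mono him (level_subset_ball (hS hx))
    · exact h.1
  refine hG.peierls hconn hFm fun v hv w hw hvw => ?_
  have hvi : i ≤ G.dist o v := by
    rcases mem_freeSites.1 hv with rfl | h
    · rw [edist_eq_dist hconn] at hxi
      exact_mod_cast hxi.ge
    · have := h.2
      rw [mem_ball, edist_eq_dist hconn, Nat.cast_le] at this
      omega
  have hwi : w ∉ ball G o i := by
    rw [mem_ball, edist_eq_dist hconn, Nat.cast_le]
    omega
  have hwm : w ∉ ball G o m := fun h => hw (mem_freeSites.2 (.inr ⟨h, hwi⟩))
  have hwS : w ∉ S := fun h => hwi (level_subset_ball (hS h))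
  simp [background, hwS, τ.2 w hwm]

open Classical in
/-- The influence of `y` on `x` in the measures `marginal`. -/
def influence (G : SimpleGraph V) [G.LocallyFinite] (β : ℝ) (o : V) (m i : ℕ) (x y : V) : ℝ :=
  ∑ D ∈ animals G (freeSites G o m i x) x with ∃ v ∈ D, G.Adj v y,
    (4 * Real.exp (-2 * β)) ^ D.card

theorem influenceBound_marginal {g : ℕ} (hG : IsGrowing G g o) (hconn : G.Connected) (him : i ≤ m)
    (hS : S ⊆ level G o i) (hβ : 0 ≤ β) :
    InfluenceBound (marginal G β o m i S τ) fun x y => influence G β o m i x y := by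
  intro x y _ ξ ξ' hξ
  have hSi := hS.trans level_subset_ball
  rw [minusProb_marginal him hSi, minusProb_marginal him hSi]
  refine abs_minusProb_sub_le hβ (peierls_freeSites hG hconn him hS x.2 ξ)
    (peierls_freeSites hG hconn him hS x.2 ξ') (mem_freeSites.2 (.inl rfl)) fun v _ hvy => ?_
  unfold background
  split_ifs with h
  · exact hξ _ fun e => hvy (congrArg Subtype.val e)
  · rfl

theorem IsGrowing.one_le_degree_bound {g Δ : ℕ} (hG : IsGrowing G g o) (hconn : G.Connected)
    (hΔ : ∀ x, G.degree x ≤ Δ) : 1 ≤ Δ := by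
  by_contra! h
  have h0 : G.neighborFinset o = ∅ := by
    rw [← Finset.card_eq_zero, SimpleGraph.card_neighborFinset_eq_degree]
    have := hΔ o
    omega
  have := hG.one_le_sum_levelSign hconn o
  rw [h0, Finset.sum_empty] at this
  linarith

theorem variance_marginal_le {g Δ : ℕ} (hG : IsGrowing G g o) (hconn : G.Connected)
    (hΔ : ∀ x, G.degree x ≤ Δ) (him : i ≤ m) (hS : S ⊆ level G o i) (hβ : 0 ≤ β)
    (hβ' : 16 * Δ ^ 3 * Real.exp (-2 * β) ≤ 1 / 2) (f : (S → ℤˣ) → ℝ) :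
    (1 - 16 * Δ ^ 3 * Real.exp (-2 * β)) * variance (marginal G β o m i S τ) f ≤
      ∑ x : S, expect (marginal G β o m i S τ) (siteVariance (marginal G β o m i S τ) x f) := by
  have hSm : S ⊆ ball G o m := hS.trans (level_subset_ball.trans (ball_mono him))
  have hq : 0 ≤ 4 * Real.exp (-2 * β) := by positivity
  refine variance_le_of_influenceBound (marginal_pos hSm) (expect_marginal_one hSm)
    (influenceBound_marginal hG hconn him hS hβ)
    (fun x y => Finset.sum_nonneg fun _ _ => pow_nonneg hq _) (by positivity) (fun x => ?_) f
  have hE : 0 ≤ (Δ : ℝ) ^ 3 * Real.exp (-2 * β) := by positivity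
  have := sum_sum_animals_le hΔ (hG.one_le_degree_bound hconn hΔ) (freeSites G o m i x) S x hq
    (by nlinarith)
  rw [← Finset.sum_coe_sort S] at this
  refine this.trans_eq ?_
  ring

end Marginal

end IsingPlus

end

/-! ### The constants of the theorem. -/

theorem theorem4p1 (Δ g : ℕ) :
    ∃ (c₀ : ℝ → ℝ) (c : ℝ), 0 < c ∧
      (fun β : ℝ => c₀ β - 1) =O[atTop] (fun β : ℝ => Real.exp (-c * β)) ∧
      ∀ᶠ β : ℝ in atTop,
        ∀ (V : Type*) (G : SimpleGraph V) [G.LocallyFinite] (o : V),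
          G.Connected → IsingPlus.IsGrowing G g o → (∀ x : V, G.degree x ≤ Δ) →
          ∀ (m i : ℕ), i ≤ m →
          ∀ S : Finset V, S ⊆ IsingPlus.level G o i →
          ∀ (τ : IsingPlus.PlusConfig G o m) (f : (S → ℤˣ) → ℝ),
            IsingPlus.variance (IsingPlus.marginal G β o m i S τ) f ≤
              c₀ β * ∑ x : S, IsingPlus.expect (IsingPlus.marginal G β o m i S τ)
                (IsingPlus.siteVariance (IsingPlus.marginal G β o m i S τ) x f) := by
  -- 16 Δ³ e^{-2β} is the bound 4 Δ³ q on the total influence for q = 4 e^{-2β}; keeping it below 1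
  -- / 2 also makes the sum over connected sets converge.
  have hsmall : ∀ᶠ β : ℝ in atTop, 16 * (Δ : ℝ) ^ 3 * Real.exp (-2 * β) ≤ 1 / 2 := by
    have h1 : Tendsto (fun β : ℝ => Real.exp (-2 * β)) atTop (nhds 0) := by
      refine Real.tendsto_exp_atBot.comp ?_
      exact tendsto_id.const_mul_atTop_of_neg (by norm_num)
    have h2 := h1.const_mul (16 * (Δ : ℝ) ^ 3)
    rw [mul_zero] at h2
    exact (h2.eventually (gt_mem_nhds (by norm_num : (0 : ℝ) < 1 / 2))).mono fun _ h => h.le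
  refine ⟨fun β => (1 - 16 * (Δ : ℝ) ^ 3 * Real.exp (-2 * β))⁻¹, 2, two_pos, ?_, ?_⟩
  -- With e ≤ 1 / 2, (1 - e)⁻¹ - 1 = e (1 - e)⁻¹ ≤ 2 e, hence 32 = 2 * 16.
  · refine IsBigO.of_bound (32 * (Δ : ℝ) ^ 3) ?_
    filter_upwards [hsmall] with β hβ
    have h0 : 0 ≤ 16 * (Δ : ℝ) ^ 3 * Real.exp (-2 * β) := by positivity
    set e := 16 * (Δ : ℝ) ^ 3 * Real.exp (-2 * β) with he
    have h1 : (1 - e)⁻¹ - 1 = e * (1 - e)⁻¹ := by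
      have : 1 - e ≠ 0 := by linarith
      field_simp
      ring
    have h2 : (1 - e)⁻¹ ≤ 2 := by
      rw [inv_le_comm₀ (by linarith) two_pos]
      linarith
    have h3 : 0 ≤ (1 - e)⁻¹ := inv_nonneg.2 (by linarith)
    rw [Real.norm_of_nonneg (Real.exp_pos _).le, h1, Real.norm_of_nonneg (mul_nonneg h0 h3)]
    calc e * (1 - e)⁻¹ ≤ e * 2 := mul_le_mul_of_nonneg_left h2 h0
      _ = _ := by rw [he]; ring
  · filter_upwards [hsmall, eventually_ge_atTop 0] with β hβ hβ0 V G _ o hconn hG hΔ m i him S hS τ f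
    rw [inv_mul_eq_div, le_div_iff₀' (by linarith)]
    exact IsingPlus.variance_marginal_le hG hconn hΔ him hS hβ0 hβ f
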